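/- Let $n$ be even and let $V=\{1,\dots,n\}$. Choose a bijection $\pi:\binom{V}{2}\to\{1,\dots,\binom n2\}$ uniformly at random and, for $0\le t\le\binom n2$, let $G_t$ be the graph on $V$ with edge set $\{e:\pi(e)\le t\}$; the sequence $\widetilde G=(G_t)_{t=0}^{\binom n2}$ is the random graph process. For a graph property $\mathcal P$ on $V$ let $\tau(\widetilde G;\mathcal P)=\min\{t: G_t\in\mathcal P\}$ (and $\infty$ if there is no such $t$). Let $\delta_2$ be the property of having minimum degree at least $2$, and let $\mathcal{PM}$ be the property of admitting a matching of size $\lfloor n/2\rfloor$, that is, a perfect matching. Let $\mathcal M_{\mathcal{PM}}$ be the property of all graphs $G$ on $V$ such that Maker wins the perfect matching game on $E(G)$: Breaker and Maker alternately claim one previously unclaimed edge of $G$, Breaker moving first, until all edges are claimed, and Maker has a strategy which, against every strategy of Breaker, ensures that the graph on $V$ formed by Maker's edges lies in $\mathcal{PM}$. Theorem. With high probability $$\tau(\widetilde G;\mathcal M_{\mathcal{PM}})=\tau(\widetilde G;\delta_2),$$ that is, the probability of this event tends to $1$ as $n\to\infty$ through the even integers. -/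

import Mathlib

/-! ### Positional games -/

namespace PositionalGame

/-- A strategy on the board `X`: given the list `h` of all moves made so far by both players
(in chronological order), and provided that some element of the board is still unclaimed,
it selects an unclaimed element of the board. -/
structure Strategy {α : Type*} (X : Finset α) where
  move : (h : List α) → (∃ x ∈ X, x ∉ h) → α
  move_mem : ∀ h hx, move h hx ∈ X
  move_unclaimed : ∀ h hx, move h hx ∉ h

open Classical in
/-- The first `k` moves (fewer if the board is exhausted earlier) of the game on the board `X`
in which Breaker follows `β` and Maker follows `μ`. The moves are numbered `0, 1, 2, …`;
Breaker starts, so he makes the even-numbered moves. -/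
noncomputable def play {α : Type*} {X : Finset α} (β μ : Strategy X) : ℕ → List α
  | 0 => []
  | k + 1 =>
    let h := play β μ k
    if hx : ∃ x ∈ X, x ∉ h then h ++ [if Even k then β.move h hx else μ.move h hx] else h

/-- The elements claimed by Maker in a game with list of moves `l`: the odd-numbered moves. -/
def makerClaims {α : Type*} (l : List α) : Set α :=
  {x | ∃ i : ℕ, Odd i ∧ l[i]? = some x}

/-- The Maker-Breaker game `(X, F)` (Breaker starts) is a Maker's win: Maker has a strategy such
that against every strategy of Breaker, once all `#X` elements have been claimed, Maker owns all
elements of some winning set. -/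
def IsMakersWin {α : Type*} (X : Finset α) (F : Set (Set α)) : Prop :=
  ∃ μ : Strategy X, ∀ β : Strategy X, ∃ A ∈ F, A ⊆ makerClaims (play β μ X.card)

end PositionalGame

/-! ### Graph properties and games on graphs -/

namespace GraphGame

/-- The winning sets of the game on the edge set of `G` in which Maker aims at the property `P`:
the sets of edges of `G` that form a spanning subgraph with property `P`. -/
def winningSets {V : Type*} (P : Set (SimpleGraph V)) (G : SimpleGraph V) : Set (Set (Sym2 V)) :=
  {A | A ⊆ G.edgeSet ∧ SimpleGraph.fromEdgeSet A ∈ P}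

open Classical in
/-- The property `𝓜_P` of all graphs `G` such that the game on the edge set of `G`, in which
Maker aims at the property `P`, is a Maker's win. -/
def makersWin {V : Type*} [Fintype V] (P : Set (SimpleGraph V)) : Set (SimpleGraph V) :=
  {G | PositionalGame.IsMakersWin G.edgeFinset (winningSets P G)}

/-- The property of admitting a matching of size `⌊n / 2⌋`, where `n` is the number of vertices. -/
def perfMatch (V : Type*) [Fintype V] : Set (SimpleGraph V) :=
  {G | ∃ M : G.Subgraph, M.IsMatching ∧ M.edgeSet.ncard = Fintype.card V / 2}

open Classical in
/-- The property `δ_k` of having minimum degree at least `k`. -/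
def minDegreeAtLeast (V : Type*) [Fintype V] (k : ℕ) : Set (SimpleGraph V) :=
  {G | k ≤ G.minDegree}

end GraphGame

/-! ### The random graph process -/

namespace GraphProcess

/-- The orderings of the pairs of distinct vertices of the vertex set `Fin n`
(the positions are numbered `0, …, n.choose 2 - 1`). -/
abbrev PairOrdering (n : ℕ) : Type :=
  {e : Sym2 (Fin n) // ¬ e.IsDiag} ≃ Fin (n.choose 2)

/-- The graph `G_t` of the process given by the ordering `π`: its edges are the first `t` pairs. -/
def graphAt {n : ℕ} (π : PairOrdering n) (t : ℕ) : SimpleGraph (Fin n) :=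
  SimpleGraph.fromEdgeSet {e | ∃ he : ¬ e.IsDiag, (π ⟨e, he⟩ : ℕ) < t}

/-- The hitting time `min {t : G_t ∈ P}` of the property `P`, where `0 ≤ t ≤ n.choose 2`
(it is `⊤` if no graph of the process has property `P`). -/
noncomputable def hittingTime {n : ℕ} (π : PairOrdering n) (P : Set (SimpleGraph (Fin n))) : ℕ∞ :=
  sInf {τ : ℕ∞ | ∃ t : ℕ, t ≤ n.choose 2 ∧ graphAt π t ∈ P ∧ τ = t}

/-- The probability of the event `A` when the ordering of the pairs is chosen uniformly at
random among all orderings. -/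
noncomputable def prob {n : ℕ} (A : Set (PairOrdering n)) : ℝ :=
  (A.ncard : ℝ) / (Nat.card (PairOrdering n) : ℝ)

end GraphProcess

/-! ### Uniformly random bijections and pair orderings -/

section UniformBijection

open Finset

variable {ι α β : Type*} [Fintype ι] [Fintype α] [Fintype β]
  [DecidableEq α] [DecidableEq β]

/-! One inequality is deterministic: at a vertex of degree at most 1, Breaker, who moves first,
takes the only edge (`two_le_degree_of_makersWin`). It remains to show that with high probability
Maker already wins on `G_τ`, where `τ` is the hitting time of minimum degree 2.

Maker plays a pairing strategy: from disjoint pairs of edges fixed in advance she obtains at least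
one edge of each (`pairingStrategy_claims`). Let `ℓ = log n`. With high probability `τ` lies between
`m₀ = ⌊3nℓ/8⌋`, when isolated vertices still exist, and `m₁ = ⌊nℓ⌋`. Let `W` consist of the edges at
positions from `2Cn` to `m₀ - 1`, and let `S` be the vertices of degree below `ℓ/50` in `W`. There
are three kinds of pairs. Each vertex of `S` gets two of its edges in `G_τ`. Each other vertex gets
`d = ⌊ℓ/400⌋` pairs of its `W`-edges, which avoid `S` and the neighbours reserved for `S`. The first
`2Cn` edges of the process are paired consecutively, and the pairs that avoid `S` are kept.

The first two kinds make every set of fewer than `κn` vertices expand in Maker's graph, because `S`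
is scattered and small sets span few edges of `G_{m₁}` (`card_le_card_outerBoundary`). The third
kind joins every two disjoint sets of at least `κn` vertices, because some pair has both its edges
between them. Tutte's theorem then yields a perfect matching
(`exists_isPerfectMatching_of_expander`). The deterministic part is assembled in
`mem_makersWin_perfMatch`.

For the probabilities, the positions of few given pairs are dominated by independent uniform ones at
the cost of a constant factor (`mean_prod_le`). Chernoff and union bounds then show that `S` is
small and scattered, that small sets are sparse, and that large sets are joined. Only the isolated
vertices at time `m₀` need a second moment (`prob_minDegree_ge_two_le`). Since `S` depends only on
`W` and is scattered in `G_{m₁} ⊇ G_τ`, no conditioning on `τ` is needed. -/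

theorem card_equiv_extending (hαβ : Fintype.card α = Fintype.card β) (j : ι ↪ α) {f : ι → β}
    (hf : Function.Injective f) :
    #{π : α ≃ β | ∀ i, π (j i) = f i} = (Fintype.card α - Fintype.card ι).factorial := by
  classical
  let e₀ : Set.range j ≃ Set.range f :=
    (Equiv.ofInjective j j.injective).symm.trans (Equiv.ofInjective f hf)
  have h1 : Fintype.card {π : α ≃ β // ∀ x : Set.range j, π x = e₀ x} =
      Fintype.card (((Set.range j)ᶜ : Set α) ≃ ((Set.range f)ᶜ : Set β)) :=
    Fintype.card_congr (Equiv.Set.compl e₀)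
  have h2 : Fintype.card ((Set.range j)ᶜ : Set α) = Fintype.card α - Fintype.card ι := by
    rw [Fintype.card_compl_set, Set.card_range_of_injective j.injective]
  have h3 : Fintype.card ((Set.range f)ᶜ : Set β) = Fintype.card α - Fintype.card ι := by
    rw [Fintype.card_compl_set, Set.card_range_of_injective hf, hαβ]
  rw [Fintype.card_equiv (Fintype.equivOfCardEq (h2.trans h3.symm)), h2] at h1
  rw [← h1, Fintype.card_subtype]
  congr 1
  ext π
  simp only [Set.coe_eq_subtype, Subtype.forall, Set.mem_range, forall_exists_index, mem_filter,
    mem_univ, true_and, e₀, Equiv.trans_apply, Equiv.ofInjective_apply]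
  constructor
  · rintro h a i rfl
    rw [h i, Equiv.ofInjective_symm_apply]
  · intro h i
    rw [h (j i) i rfl, Equiv.ofInjective_symm_apply]

/-- Each injective `f` arises from exactly `(N - q)!` bijections and every other `f` from none.
Since `Φ ≥ 0`, dropping injectivity only increases the sum, which then runs over independent
coordinates. -/
theorem sum_comp_embedding_le [DecidableEq ι] (hαβ : Fintype.card α = Fintype.card β) (j : ι ↪ α)
    {Φ : (ι → β) → ℝ} (hΦ : ∀ f, 0 ≤ Φ f) :
    ∑ π : α ≃ β, Φ (fun i => π (j i)) ≤
      (Fintype.card α - Fintype.card ι).factorial * ∑ f, Φ f := by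
  rw [← sum_fiberwise (s := (univ : Finset (α ≃ β))) (g := fun π i => π (j i)), mul_sum]
  refine sum_le_sum fun f _ => ?_
  have h1 : ∑ π : α ≃ β with (fun i => π (j i)) = f, Φ (fun i => π (j i)) =
      #{π : α ≃ β | (fun i => π (j i)) = f} * Φ f := by
    rw [← nsmul_eq_mul, ← sum_const]
    refine sum_congr rfl fun π hπ => ?_
    rw [(mem_filter.1 hπ).2]
  rw [h1]
  refine mul_le_mul_of_nonneg_right ?_ (hΦ f)
  norm_cast
  by_cases hf : Function.Injective f
  · rw [← card_equiv_extending hαβ j hf]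
    exact card_le_card fun π hπ => by
      simp only [mem_filter, mem_univ, true_and] at hπ ⊢
      exact fun i => congrFun hπ i
  · rw [card_eq_zero.2]
    · exact Nat.zero_le _
    · rw [filter_eq_empty_iff]
      rintro π - rfl
      exact hf (π.injective.comp j.injective)

theorem card_equiv_mapsTo (hαβ : Fintype.card α = Fintype.card β) (Q : Finset α) (J : Finset β) :
    #{π : α ≃ β | ∀ e ∈ Q, π e ∈ J} =
      (Fintype.card α - #Q).factorial * (#J).descFactorial #Q := by
  have h1 := card_eq_sum_card_fiberwise (f := fun (π : α ≃ β) (e : Q) => π e.1)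
    (s := {π : α ≃ β | ∀ e ∈ Q, π e ∈ J})
    (t := univ.image fun (g : Q ↪ J) (e : Q) => (g e : β)) (by
      intro π hπ
      simp only [coe_filter, mem_univ, true_and, Set.mem_ofPred_eq] at hπ
      simp only [coe_image, coe_univ, Set.image_univ, Set.mem_range]
      exact ⟨⟨fun e => ⟨π e.1, hπ e.1 e.2⟩, fun a b hab => by simpa using hab⟩, rfl⟩)
  rw [h1, sum_congr rfl (g := fun _ => (Fintype.card α - #Q).factorial), sum_const,
    card_image_of_injective, card_univ, Fintype.card_embedding_eq, Fintype.card_coe,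
    Fintype.card_coe, smul_eq_mul, mul_comm]
  · intro g g' h
    ext e
    exact congrFun h e
  · intro f hf
    obtain ⟨g, -, rfl⟩ := mem_image.1 hf
    have hinj : Function.Injective fun e : Q => (g e : β) :=
      Subtype.val_injective.comp g.injective
    have h2 := card_equiv_extending hαβ (Function.Embedding.subtype (· ∈ Q)) hinj
    rw [Fintype.card_coe] at h2
    rw [← h2, filter_filter]
    congr 1
    ext π
    rw [mem_filter, mem_filter, funext_iff]
    constructor
    · exact fun h => ⟨h.1, h.2.2⟩
    · exact fun h => ⟨h.1, fun e he => (h.2 ⟨e, he⟩ : π e = _) ▸ (g ⟨e, he⟩).2, h.2⟩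

end UniformBijection

/-! ### Means, union bounds and lower tails for a uniformly random ordering. -/

namespace GraphProcess

open Finset

variable {n : ℕ}

theorem card_pairs : Fintype.card {e : Sym2 (Fin n) // ¬ e.IsDiag} = n.choose 2 := by
  rw [Sym2.card_subtype_not_diag, Fintype.card_fin]

theorem card_pairs_eq :
    Fintype.card {e : Sym2 (Fin n) // ¬ e.IsDiag} = Fintype.card (Fin (n.choose 2)) := by
  rw [card_pairs, Fintype.card_fin]

theorem card_pairOrdering : Fintype.card (PairOrdering n) = (n.choose 2).factorial := by
  rw [Fintype.card_equiv (Fintype.equivOfCardEq card_pairs_eq), card_pairs]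

theorem card_pairOrdering_pos : (0 : ℝ) < Fintype.card (PairOrdering n) := by
  rw [card_pairOrdering]; exact_mod_cast Nat.factorial_pos _

/-- The mean of `Φ` over all orderings. -/
noncomputable def mean (Φ : PairOrdering n → ℝ) : ℝ :=
  (∑ π, Φ π) / Fintype.card (PairOrdering n)

open Classical in
theorem prob_eq_mean (A : Set (PairOrdering n)) :
    prob A = mean fun π => if π ∈ A then 1 else 0 := by
  rw [prob, mean, Nat.card_eq_fintype_card, sum_boole, Set.ncard_eq_toFinset_card']
  congr 2
  congr 1
  ext π
  simp

theorem mean_mono {Φ Ψ : PairOrdering n → ℝ} (h : ∀ π, Φ π ≤ Ψ π) : mean Φ ≤ mean Ψ :=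
  div_le_div_of_nonneg_right (sum_le_sum fun π _ => h π) (Nat.cast_nonneg _)

theorem mean_const_mul (c : ℝ) (Φ : PairOrdering n → ℝ) :
    (mean fun π => c * Φ π) = c * mean Φ := by
  rw [mean, mean, ← mul_sum, mul_div_assoc]

theorem mean_add (Φ Ψ : PairOrdering n → ℝ) :
    (mean fun π => Φ π + Ψ π) = mean Φ + mean Ψ := by
  rw [mean, mean, mean, sum_add_distrib, add_div]

theorem mean_sum {ι : Type*} (s : Finset ι) (Φ : ι → PairOrdering n → ℝ) :
    (mean fun π => ∑ i ∈ s, Φ i π) = ∑ i ∈ s, mean (Φ i) := by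
  simp only [mean]
  rw [sum_comm, sum_div]

theorem mean_const (c : ℝ) : (mean fun _ : PairOrdering n => c) = c := by
  rw [mean, sum_const, card_univ, nsmul_eq_mul]
  have := card_pairOrdering_pos (n := n)
  field_simp

theorem prob_le_mean {A : Set (PairOrdering n)} {Φ : PairOrdering n → ℝ} (h0 : ∀ π, 0 ≤ Φ π)
    (h1 : ∀ π ∈ A, 1 ≤ Φ π) : prob A ≤ mean Φ := by
  classical
  rw [prob_eq_mean]
  refine mean_mono fun π => ?_
  split_ifs with h
  · exact h1 π h
  · exact h0 π

theorem prob_nonneg (A : Set (PairOrdering n)) : 0 ≤ prob A := by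
  rw [prob]; positivity

theorem prob_mono {A B : Set (PairOrdering n)} (h : A ⊆ B) : prob A ≤ prob B := by
  classical
  rw [prob_eq_mean B]
  refine prob_le_mean (fun π => by positivity) fun π hπ => ?_
  rw [if_pos (h hπ)]

theorem prob_compl (A : Set (PairOrdering n)) : prob Aᶜ = 1 - prob A := by
  classical
  rw [eq_sub_iff_add_eq, prob_eq_mean Aᶜ, prob_eq_mean A, ← mean_add]
  refine Eq.trans ?_ (mean_const (n := n) 1)
  congr 1
  ext π
  by_cases h : π ∈ A <;> simp [h]

theorem prob_le_one (A : Set (PairOrdering n)) : prob A ≤ 1 := by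
  have := prob_nonneg Aᶜ
  rw [prob_compl] at this
  linarith

theorem prob_le_sum {ι : Type*} (s : Finset ι) {A : Set (PairOrdering n)}
    {B : ι → Set (PairOrdering n)} (h : ∀ π ∈ A, ∃ i ∈ s, π ∈ B i) :
    prob A ≤ ∑ i ∈ s, prob (B i) := by
  classical
  simp only [prob_eq_mean (B _)]
  rw [← mean_sum]
  refine prob_le_mean (fun π => sum_nonneg fun i _ => by positivity) fun π hπ => ?_
  obtain ⟨i, hi, hB⟩ := h π hπ
  refine le_trans ?_ (single_le_sum (f := fun i => if π ∈ B i then (1 : ℝ) else 0)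
    (fun j _ => by positivity) hi)
  rw [if_pos hB]

theorem prob_union_le (A B : Set (PairOrdering n)) : prob (A ∪ B) ≤ prob A + prob B := by
  have := prob_le_sum (n := n) (univ : Finset Bool) (A := A ∪ B) (B := fun b => if b then A else B)
    (by
      rintro π (h | h)
      · exact ⟨true, mem_univ _, by simpa⟩
      · exact ⟨false, mem_univ _, by simpa⟩)
  simpa using this

theorem factorial_ratio_le {N q : ℕ} (hq : q < N) :
    ((N - q).factorial : ℝ) / N.factorial ≤ 1 / ((N : ℝ) - q) ^ q := by
  have h1 := Nat.pow_sub_le_descFactorial N q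
  have h2 := Nat.factorial_mul_descFactorial hq.le
  have h3 : ((N : ℝ) - q) ^ q ≤ N.descFactorial q := by
    calc ((N : ℝ) - q) ^ q ≤ ((N + 1 - q : ℕ) : ℝ) ^ q := by
          have : ((N : ℝ) - q) ≤ ((N + 1 - q : ℕ) : ℝ) := by
            rw [Nat.cast_sub (by omega)]; push_cast; linarith
          have h0 : (0 : ℝ) ≤ (N : ℝ) - q := by
            rw [sub_nonneg]; exact_mod_cast hq.le
          gcongr
      _ ≤ _ := by exact_mod_cast h1
  have hpos : (0 : ℝ) < ((N : ℝ) - q) ^ q := by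
    apply pow_pos; rw [sub_pos]; exact_mod_cast hq
  rw [← h2, div_le_div_iff₀ (by rw [h2]; exact_mod_cast Nat.factorial_pos _) hpos]
  push_cast
  have : (0 : ℝ) < (N - q).factorial := by exact_mod_cast Nat.factorial_pos _
  nlinarith

/-- The images of few pairs are dominated by independent uniform positions. -/
theorem mean_prod_le (Q : Finset {e : Sym2 (Fin n) // ¬ e.IsDiag}) (hQ : #Q < n.choose 2)
    {w : {e : Sym2 (Fin n) // ¬ e.IsDiag} → Fin (n.choose 2) → ℝ} (hw : ∀ e t, 0 ≤ w e t) :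
    (mean fun π => ∏ e ∈ Q, w e (π e)) ≤
      ∏ e ∈ Q, ((∑ t, w e t) / ((n.choose 2 : ℕ) - #Q : ℝ)) := by
  classical
  have h1 := sum_comp_embedding_le card_pairs_eq (Function.Embedding.subtype (· ∈ Q))
    (Φ := fun f => ∏ e : Q, w e.1 (f e)) (fun f => prod_nonneg fun e _ => hw _ _)
  have h2 : ∑ f : Q → Fin (n.choose 2), ∏ e : Q, w e.1 (f e) = ∏ e ∈ Q, ∑ t, w e t := by
    rw [← prod_coe_sort Q (fun e => ∑ t, w e t), prod_univ_sum, Fintype.piFinset_univ]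
  have h3 : ∀ π : PairOrdering n, ∏ e : Q, w e.1 (π e.1) = ∏ e ∈ Q, w e (π e) := fun π =>
    prod_coe_sort Q (fun e => w e (π e))
  simp only [Function.Embedding.subtype_apply, h3, h2, Fintype.card_coe] at h1
  rw [mean, card_pairOrdering, prod_div_distrib, prod_const, div_le_iff₀
    (by exact_mod_cast Nat.factorial_pos _)]
  refine h1.trans ?_
  have h4 := factorial_ratio_le hQ
  rw [div_le_iff₀ (by exact_mod_cast Nat.factorial_pos _)] at h4
  rw [card_pairs]
  have h5 : 0 ≤ ∏ e ∈ Q, ∑ t, w e t := prod_nonneg fun e _ => sum_nonneg fun t _ => hw _ _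
  calc _ ≤ (1 / ((n.choose 2 : ℕ) - #Q : ℝ) ^ #Q * (n.choose 2).factorial) *
        ∏ e ∈ Q, ∑ t, w e t := by gcongr
    _ = _ := by ring

theorem prob_mapsTo_le (F : Finset {e : Sym2 (Fin n) // ¬ e.IsDiag}) (hF : #F < n.choose 2)
    (J : Finset (Fin (n.choose 2))) :
    prob {π : PairOrdering n | ∀ e ∈ F, π e ∈ J} ≤
      ((#J : ℝ) / ((n.choose 2 : ℕ) - #F : ℝ)) ^ #F := by
  have h := mean_prod_le F hF (w := fun _ t => if t ∈ J then 1 else 0) (fun e t => by positivity)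
  simp only [sum_boole, prod_const, filter_mem_eq_inter, univ_inter] at h
  refine le_trans (prob_le_mean (fun π => prod_nonneg fun e _ => by positivity) ?_) h
  intro π hπ
  rw [prod_congr rfl (g := fun _ => 1)]
  · simp
  · intro e he
    rw [if_pos (hπ e he)]

theorem choose_two_bounds (hn : 10 ≤ n) :
    (n : ℝ) ^ 2 / 8 ≤ (n.choose 2 : ℕ) - 3 * (n : ℝ) ∧ (n : ℝ) ^ 2 / 4 ≤ (n.choose 2 : ℕ) ∧
      ((n.choose 2 : ℕ) : ℝ) ≤ (n : ℝ) ^ 2 / 2 := by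
  have h : (10 : ℝ) ≤ n := by exact_mod_cast hn
  rw [Nat.cast_choose_two]
  refine ⟨by nlinarith, by nlinarith, by nlinarith⟩

/-- Lower tail for the number of pairs of `Q` with a position in `I`, jointly with the event that
the pairs of `F` have their positions in `J`. -/
theorem prob_lower_tail (hn : 10 ≤ n) {F Q : Finset {e : Sym2 (Fin n) // ¬ e.IsDiag}}
    (hFQ : Disjoint F Q) (hc : #F + #Q ≤ 3 * n) (I J : Finset (Fin (n.choose 2))) (r : ℝ) :
    prob {π : PairOrdering n | (∀ e ∈ F, π e ∈ J) ∧ (#{e ∈ Q | π e ∈ I} : ℝ) ≤ r} ≤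
      Real.exp 72 * (8 : ℝ) ^ r * ((#J : ℝ) / (n.choose 2 : ℕ)) ^ #F *
        Real.exp (-(7 / 8 * #Q * (#I / (n.choose 2 : ℕ)))) := by
  classical
  set N : ℝ := ((n.choose 2 : ℕ) : ℝ) with hN
  obtain ⟨hN1, hN2, -⟩ := choose_two_bounds hn
  rw [← hN] at hN1 hN2
  have hn' : (10 : ℝ) ≤ n := by exact_mod_cast hn
  have hNpos : (0 : ℝ) < N := by nlinarith
  set q := #(F ∪ Q) with hq
  have hqc : q = #F + #Q := card_union_of_disjoint hFQ
  have hq3 : (q : ℝ) ≤ 3 * n := by rw [hqc]; exact_mod_cast hc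
  have hqN : (q : ℝ) < N := by nlinarith
  have hqN' : q < n.choose 2 := by rw [hN] at hqN; exact_mod_cast hqN
  -- Chernoff weights: on `F` an indicator; on `Q` a factor `1/8` for each hit of `I`, so that at
  -- most `r` hits give a product of at least `8 ^ (-r)`. The base 8 keeps `7/8` of the optimal
  -- exponential rate.
  set w : {e : Sym2 (Fin n) // ¬ e.IsDiag} → Fin (n.choose 2) → ℝ := fun e t =>
    if e ∈ F then (if t ∈ J then 1 else 0) else (if t ∈ I then 1 / 8 else 1) with hw
  have hw0 : ∀ e t, 0 ≤ w e t := fun e t => by simp only [hw]; positivity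
  have hmean := mean_prod_le (F ∪ Q) hqN' hw0
  have hsumF : ∀ e ∈ F, ∑ t, w e t = #J := fun e he => by simp [hw, he]
  have hsumQ : ∀ e ∈ Q, ∑ t, w e t = N - 7 / 8 * #I := fun e he => by
    have he' : e ∉ F := fun h => Finset.disjoint_left.1 hFQ h he
    have : ∀ t, w e t = 1 - 7 / 8 * (if t ∈ I then 1 else 0) := fun t => by
      simp only [hw, he', if_false]; split_ifs <;> norm_num
    simp only [this, sum_sub_distrib, ← mul_sum]
    simp [hN]
  have hIN : (#I : ℝ) ≤ N := by
    have := card_le_univ I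
    rw [Fintype.card_fin] at this
    rw [hN]; exact_mod_cast this
  -- This is the cost of pretending independence: `q ≤ 3n` and `N - q ≥ n²/8` give `q²/(N - q) ≤
  -- 72`.
  have hfac : ((N : ℝ) / (N - q)) ^ q ≤ Real.exp 72 := by
    have h1 : (N : ℝ) / (N - q) ≤ Real.exp (q / (N - q)) := by
      have := Real.add_one_le_exp ((q : ℝ) / (N - q))
      refine le_trans (le_of_eq ?_) this
      have : (N : ℝ) - q ≠ 0 := by linarith
      field_simp
      ring
    have hd : (0 : ℝ) < N - q := by linarith
    calc ((N : ℝ) / (N - q)) ^ q ≤ Real.exp (q / (N - q)) ^ q := by gcongr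
      _ = Real.exp (q * (q / (N - q))) := (Real.exp_nat_mul _ _).symm
      _ ≤ Real.exp 72 := by
        apply Real.exp_le_exp.2
        rw [← mul_div_assoc, div_le_iff₀ hd]
        nlinarith
  have hprod : ∏ e ∈ F ∪ Q, ((∑ t, w e t) / ((N : ℝ) - q)) =
      ((N : ℝ) / (N - q)) ^ q * ((#J : ℝ) / N) ^ #F * (1 - 7 / 8 * (#I / N)) ^ #Q := by
    rw [prod_union hFQ, prod_congr rfl fun e he => by rw [hsumF e he],
      prod_congr (s₁ := Q) rfl fun e he => by rw [hsumQ e he], prod_const, prod_const, hqc,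
      pow_add, mul_assoc, mul_mul_mul_comm, ← mul_pow, ← mul_pow]
    have hd : ((N : ℝ) - ((#F + #Q : ℕ) : ℝ)) ≠ 0 := by rw [← hqc]; linarith
    congr 2
    · field_simp
    · field_simp
  have hexp : (1 - 7 / 8 * ((#I : ℝ) / N)) ^ #Q ≤ Real.exp (-(7 / 8 * #Q * (#I / N))) := by
    have h0 : 0 ≤ 1 - 7 / 8 * ((#I : ℝ) / N) := by
      have : (#I : ℝ) / N ≤ 1 := div_le_one_of_le₀ hIN hNpos.le
      linarith
    calc _ ≤ Real.exp (-(7 / 8 * (#I / N))) ^ #Q := by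
          have := Real.add_one_le_exp (-(7 / 8 * ((#I : ℝ) / N)))
          gcongr
          linarith
      _ = _ := by rw [← Real.exp_nat_mul]; congr 1; ring
  calc prob {π : PairOrdering n | (∀ e ∈ F, π e ∈ J) ∧ (#{e ∈ Q | π e ∈ I} : ℝ) ≤ r}
      ≤ mean fun π => (8 : ℝ) ^ r * ∏ e ∈ F ∪ Q, w e (π e) := by
        refine prob_le_mean (fun π => mul_nonneg (by positivity) (prod_nonneg fun e _ => hw0 _ _)) ?_
        rintro π ⟨hF, hr⟩
        rw [prod_union hFQ, prod_congr rfl (g := fun _ => (1 : ℝ)), prod_const_one, one_mul,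
          prod_congr (s₁ := Q) rfl (g := fun e => if π e ∈ I then (1 / 8 : ℝ) else 1),
          prod_ite, prod_const_one, mul_one, prod_const]
        · rw [← Real.rpow_natCast, one_div, Real.inv_rpow (by norm_num), ← div_eq_mul_inv,
            one_le_div (by positivity)]
          exact Real.rpow_le_rpow_of_exponent_le (by norm_num) hr
        · intro e he
          have he' : e ∉ F := fun h => Finset.disjoint_left.1 hFQ h he
          simp only [hw, he', if_false]
        · intro e he
          simp only [hw, he, if_true, hF e he]
    _ ≤ (8 : ℝ) ^ r * (((N : ℝ) / (N - q)) ^ q * ((#J : ℝ) / N) ^ #F *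
          (1 - 7 / 8 * (#I / N)) ^ #Q) := by
        rw [mean_const_mul, ← hprod]
        gcongr
    _ ≤ (8 : ℝ) ^ r * (Real.exp 72 * ((#J : ℝ) / N) ^ #F *
          Real.exp (-(7 / 8 * #Q * (#I / N)))) := by
        have h0 : 0 ≤ 1 - 7 / 8 * ((#I : ℝ) / N) := by
          have : (#I : ℝ) / N ≤ 1 := div_le_one_of_le₀ hIN hNpos.le
          linarith
        gcongr
    _ = _ := by ring

end GraphProcess

/-! ### Pairing strategies -/

namespace PositionalGame

variable {α : Type*} {X : Finset α}

theorem exists_unclaimed {l : List α} (h : l.length < X.card) : ∃ x ∈ X, x ∉ l := by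
  classical
  by_contra! hc
  have : X ⊆ l.toFinset := fun x hx => List.mem_toFinset.2 (hc x hx)
  have := (Finset.card_le_card this).trans l.toFinset_card_le
  omega

theorem play_spec (β μ : Strategy X) {k : ℕ} (hk : k ≤ X.card) :
    (play β μ k).length = k ∧ (play β μ k).Nodup ∧ ∀ x ∈ play β μ k, x ∈ X := by
  induction k with
  | zero => simp [play]
  | succ k ih =>
    obtain ⟨h1, h2, h3⟩ := ih (by omega)
    have hx : ∃ x ∈ X, x ∉ play β μ k := exists_unclaimed (by omega)
    simp only [play, hx, dite_true]
    refine ⟨by simp [h1], ?_, ?_⟩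
    · rw [List.nodup_append]
      refine ⟨h2, by simp, ?_⟩
      intro a ha b hb
      rw [List.mem_singleton] at hb
      rintro rfl
      subst hb
      split_ifs at ha
      · exact β.move_unclaimed _ _ ha
      · exact μ.move_unclaimed _ _ ha
    · intro x hx'
      rw [List.mem_append, List.mem_singleton] at hx'
      rcases hx' with hx' | rfl
      · exact h3 x hx'
      · split_ifs
        · exact β.move_mem _ _
        · exact μ.move_mem _ _

theorem exists_unclaimed_play (β μ : Strategy X) {k : ℕ} (hk : k < X.card) :
    ∃ x ∈ X, x ∉ play β μ k :=
  exists_unclaimed (by rw [(play_spec β μ hk.le).1]; exact hk)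

theorem play_succ (β μ : Strategy X) {k : ℕ} (hk : k < X.card) :
    play β μ (k + 1) = play β μ k ++
      [if Even k then β.move (play β μ k) (exists_unclaimed_play β μ hk)
        else μ.move (play β μ k) (exists_unclaimed_play β μ hk)] := by
  simp only [play, exists_unclaimed_play β μ hk, dite_true]

theorem take_play (β μ : Strategy X) {j k : ℕ} (hk : k ≤ j) (hj : j ≤ X.card) :
    (play β μ j).take k = play β μ k := by
  induction j, hk using Nat.le_induction with
  | base => rw [List.take_of_length_le]; exact (play_spec β μ hj).1.le
  | succ j hkj ih =>
    rw [play_succ β μ (by omega), List.take_append_of_le_length, ih (by omega)]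
    rw [(play_spec β μ (by omega)).1]; exact hkj

theorem getElem?_play (β μ : Strategy X) {j k : ℕ} (hk : k < j) (hj : j ≤ X.card) :
    (play β μ j)[k]? = some (if Even k then
        β.move (play β μ k) (exists_unclaimed_play β μ (hk.trans_le hj))
      else μ.move (play β μ k) (exists_unclaimed_play β μ (hk.trans_le hj))) := by
  have h1 : (play β μ j)[k]? = (play β μ (k + 1))[k]? := by
    rw [← take_play β μ (show k + 1 ≤ j from hk) hj, List.getElem?_take_of_lt (by omega)]
  rw [h1, play_succ β μ (hk.trans_le hj), List.getElem?_append_right,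
    (play_spec β μ (hk.le.trans hj)).1]
  · simp
  · rw [(play_spec β μ (hk.le.trans hj)).1]

theorem mem_play_card (β μ : Strategy X) {x : α} (hx : x ∈ X) : x ∈ play β μ X.card := by
  classical
  obtain ⟨h1, h2, h3⟩ := play_spec β μ le_rfl
  have h4 : (play β μ X.card).toFinset = X := by
    apply Finset.eq_of_subset_of_card_le
    · intro y hy; exact h3 y (List.mem_toFinset.1 hy)
    · rw [List.toFinset_card_of_nodup h2, h1]
  rw [← h4] at hx
  exact List.mem_toFinset.1 hx

theorem makerClaims_subset (β μ : Strategy X) : makerClaims (play β μ X.card) ⊆ X := by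
  rintro x ⟨i, -, hi⟩
  exact (play_spec β μ le_rfl).2.2 x (List.mem_of_getElem? hi)

open Classical in
/-- The pairing strategy: whenever the opponent has just claimed one member of a pair `f i`,
claim the other one, if it is available. -/
noncomputable def pairingStrategy {ι : Type*} (X : Finset α) (f : ι × Bool → α) : Strategy X where
  move h hx :=
    if hc : ∃ y ∈ X, y ∉ h ∧ ∃ i c, h.getLast? = some (f (i, c)) ∧ y = f (i, !c)
    then hc.choose else hx.choose
  move_mem h hx := by
    split_ifs with hc
    · exact hc.choose_spec.1
    · exact hx.choose_spec.1
  move_unclaimed h hx := by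
    split_ifs with hc
    · exact hc.choose_spec.2.1
    · exact hx.choose_spec.2

theorem pairingStrategy_move {ι : Type*} {f : ι × Bool → α} (hf : Function.Injective f)
    {h : List α} (hx : ∃ x ∈ X, x ∉ h) {i : ι} {c : Bool} (hl : h.getLast? = some (f (i, c)))
    (hX : f (i, !c) ∈ X) (hu : f (i, !c) ∉ h) :
    (pairingStrategy X f).move h hx = f (i, !c) := by
  have hc : ∃ y ∈ X, y ∉ h ∧ ∃ i c, h.getLast? = some (f (i, c)) ∧ y = f (i, !c) :=
    ⟨_, hX, hu, i, c, hl, rfl⟩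
  simp only [pairingStrategy, hc, dite_true]
  obtain ⟨-, -, i', c', h1, h2⟩ := hc.choose_spec
  rw [h2]
  rw [hl, Option.some.injEq] at h1
  have := hf h1
  simp only [Prod.mk.injEq] at this
  rw [this.1, this.2]

/-- If Breaker owned both members of a pair, then right after he took the earlier one the other was
free, and the strategy would have claimed it at once. -/
theorem pairingStrategy_claims {ι : Type*} {f : ι × Bool → α} (hf : Function.Injective f)
    (hX : ∀ p, f p ∈ X) (β : Strategy X) (i : ι) :
    ∃ c, f (i, c) ∈ makerClaims (play β (pairingStrategy X f) X.card) := by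
  set μ := pairingStrategy X f
  have hmem : ∀ c, ∃ k : ℕ, (play β μ X.card)[k]? = some (f (i, c)) := fun c =>
    List.mem_iff_getElem?.1 (mem_play_card β μ (hX _))
  choose k hk using hmem
  by_contra! hno
  have heven : ∀ c, Even (k c) := fun c => by
    by_contra ho
    exact hno c ⟨k c, Nat.not_even_iff_odd.1 ho, hk c⟩
  have hlt : ∀ c, k c < X.card := fun c => by
    have := (List.getElem?_eq_some_iff.1 (hk c)).1
    rwa [(play_spec β μ le_rfl).1] at this
  have hnd := (play_spec β μ (le_refl X.card)).2.1
  -- The partner is claimed later, so the board is not exhausted after move `k c` and Maker does get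
  -- to answer.
  have key : ∀ c, k c < k (!c) → False := fun c hc => by
    have hkX : k c + 1 < X.card := by have := hlt (!c); omega
    have hlast : (play β μ (k c + 1)).getLast? = some (f (i, c)) := by
      rw [List.getLast?_eq_getElem?, (play_spec β μ hkX.le).1, Nat.add_sub_cancel,
        ← take_play β μ hkX.le le_rfl, List.getElem?_take_of_lt (by omega), hk c]
    have hun : f (i, !c) ∉ play β μ (k c + 1) := fun hin => by
      obtain ⟨j, hj⟩ := List.mem_iff_getElem?.1 hin
      have hjlt := (List.getElem?_eq_some_iff.1 hj).1
      rw [(play_spec β μ hkX.le).1] at hjlt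
      rw [← take_play β μ hkX.le le_rfl, List.getElem?_take_of_lt hjlt] at hj
      have h3 := (List.getElem?_inj (i := j) (j := k (!c))
        (by rw [(play_spec β μ le_rfl).1]; omega) hnd).1 (hj.trans (hk (!c)).symm)
      omega
    have hmove := getElem?_play β μ hkX le_rfl
    have hodd : ¬ Even (k c + 1) := by rw [Nat.even_add_one, not_not]; exact heven c
    rw [if_neg hodd, pairingStrategy_move hf _ hlast (hX _) hun] at hmove
    exact hno (!c) ⟨k c + 1, Nat.not_even_iff_odd.1 hodd, hmove⟩
  have hne : k false ≠ k true := fun h => by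
    have h1 := hk false
    rw [h, hk true, Option.some.injEq] at h1
    simpa using hf h1
  rcases lt_or_gt_of_ne hne with h | h
  · exact key false h
  · exact key true h

open Classical in
/-- The strategy that claims `e` as soon as possible. -/
noncomputable def claimFirst (X : Finset α) (e : α) : Strategy X where
  move h hx := if e ∈ X ∧ e ∉ h then e else hx.choose
  move_mem h hx := by
    split_ifs with hc
    · exact hc.1
    · exact hx.choose_spec.1
  move_unclaimed h hx := by
    split_ifs with hc
    · exact hc.2
    · exact hx.choose_spec.2

theorem notMem_makerClaims_claimFirst (μ : Strategy X) (e : α) :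
    e ∉ makerClaims (play (claimFirst X e) μ X.card) := by
  intro he
  have heX : e ∈ X := makerClaims_subset _ _ he
  obtain ⟨i, hi, hie⟩ := he
  have hpos : 0 < X.card := Finset.card_pos.2 ⟨e, heX⟩
  have h0 := getElem?_play (claimFirst X e) μ hpos le_rfl
  have hm : ∀ hx, (claimFirst X e).move [] hx = e := fun hx => by simp [claimFirst, heX]
  simp only [Even.zero, if_true, play, hm] at h0
  have hnd := (play_spec (claimFirst X e) μ (le_refl X.card)).2.1
  have := (List.getElem?_inj (i := 0) (j := i)
    (by rw [(play_spec (claimFirst X e) μ le_rfl).1]; exact hpos) hnd).1 (h0.trans hie.symm)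
  subst this
  simp at hi

end PositionalGame

/-! ### Perfect matchings in expanding graphs -/

namespace SimpleGraph

open Finset

variable {V : Type*} [Fintype V] {G : SimpleGraph V}

open Classical in
/-- The set of vertices outside `A` that have a neighbour in `A`. -/
noncomputable def outerBoundary (G : SimpleGraph V) (A : Finset V) : Finset V :=
  {v | v ∉ A ∧ ∃ u ∈ A, G.Adj u v}

theorem mem_outerBoundary {A : Finset V} {v : V} :
    v ∈ G.outerBoundary A ↔ v ∉ A ∧ ∃ u ∈ A, G.Adj u v := by
  simp [outerBoundary]

/-- The cells are unions of components of `G - S`. No family of cells and its complement can both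
have `x` vertices, since no edge joins them. Hence one cell is huge, and the rest `U` has fewer than
`x` vertices with boundary inside `S`, so expansion gives `#U ≤ #S`, while each remaining cell
contributes at least one vertex to `U`. -/
theorem card_cells_le_of_expander {κ : Type*} [Fintype κ] {x : ℝ}
    (h1 : ∀ A : Finset V, (#A : ℝ) < x → #A ≤ #(G.outerBoundary A))
    (h2 : ∀ A B : Finset V, Disjoint A B → x ≤ #A → x ≤ #B → ∃ a ∈ A, ∃ b ∈ B, G.Adj a b)
    (h6 : 6 * x ≤ Fintype.card V) (S : Finset V) (cell : κ → Finset V)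
    (hne : ∀ c, (cell c).Nonempty) (hS : ∀ c, ∀ v ∈ cell c, v ∉ S)
    (hdisj : ∀ c d, ∀ v ∈ cell c, v ∈ cell d → c = d) (hcov : ∀ v, v ∉ S → ∃ c, v ∈ cell c)
    (hadj : ∀ c d, ∀ u ∈ cell c, ∀ v ∈ cell d, G.Adj u v → c = d) :
    Fintype.card κ ≤ #S + 1 := by
  classical
  by_contra! hk
  have hpd : ∀ 𝒞 : Finset κ, ∀ c ∈ 𝒞, ∀ d ∈ 𝒞, c ≠ d → Disjoint (cell c) (cell d) :=
    fun 𝒞 c _ d _ hcd => Finset.disjoint_left.2 fun v hv hv' => hcd (hdisj c d v hv hv')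
  have hcard : ∀ 𝒞 : Finset κ, #𝒞 ≤ #(𝒞.biUnion cell) := fun 𝒞 => by
    rw [card_biUnion (hpd 𝒞), card_eq_sum_ones]
    exact sum_le_sum fun c _ => (hne c).card_pos
  have hdj : ∀ 𝒞 : Finset κ, Disjoint (𝒞.biUnion cell) (𝒞ᶜ.biUnion cell) := fun 𝒞 => by
    rw [Finset.disjoint_left]
    intro v hv hv'
    obtain ⟨c, hc, hvc⟩ := mem_biUnion.1 hv
    obtain ⟨d, hd, hvd⟩ := mem_biUnion.1 hv'
    rw [mem_compl] at hd
    exact hd (hdisj c d v hvc hvd ▸ hc)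
  have hT : ∀ 𝒞 : Finset κ, #(𝒞.biUnion cell) + #(𝒞ᶜ.biUnion cell) + #S = Fintype.card V := by
    intro 𝒞
    have hS' : Sᶜ = 𝒞.biUnion cell ∪ 𝒞ᶜ.biUnion cell := by
      ext v
      simp only [mem_compl, mem_union, mem_biUnion]
      constructor
      · intro hv
        obtain ⟨c, hc⟩ := hcov v hv
        by_cases h : c ∈ 𝒞
        · exact .inl ⟨c, h, hc⟩
        · exact .inr ⟨c, h, hc⟩
      · rintro (⟨c, -, hc⟩ | ⟨c, -, hc⟩) <;> exact hS c v hc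
    rw [← card_union_of_disjoint (hdj 𝒞), ← hS', card_compl]
    have := card_le_univ S
    omega
  have hnot : ∀ 𝒞 : Finset κ, x ≤ #(𝒞.biUnion cell) → x ≤ #(𝒞ᶜ.biUnion cell) → False := by
    intro 𝒞 ha hb
    obtain ⟨a, ha, b, hb, hab⟩ := h2 _ _ (hdj 𝒞) ha hb
    obtain ⟨c, hc, hac⟩ := mem_biUnion.1 ha
    obtain ⟨d, hd, hbd⟩ := mem_biUnion.1 hb
    rw [mem_compl] at hd
    exact hd (hadj c d a hac b hbd hab ▸ hc)
  -- There are more cells than vertices of `S`, so the cells cover at least half of the vertices.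
  have hT2 : 3 * x ≤ #(univ.biUnion cell) := by
    have e1 := hT univ
    have e2 := hcard univ
    rw [card_univ] at e2
    simp only [compl_univ, biUnion_empty, card_empty, add_zero] at e1
    have : Fintype.card V ≤ 2 * #(univ.biUnion cell) := by omega
    have : (Fintype.card V : ℝ) ≤ 2 * #(univ.biUnion cell) := by exact_mod_cast this
    linarith
  have hTr : ∀ 𝒞 : Finset κ, (#(𝒞.biUnion cell) : ℝ) + #(𝒞ᶜ.biUnion cell) =
      #(univ.biUnion cell) := fun 𝒞 => by
    have e1 := hT 𝒞
    have e2 := hT univ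
    simp only [compl_univ, biUnion_empty, card_empty, add_zero] at e2
    exact_mod_cast show #(𝒞.biUnion cell) + #(𝒞ᶜ.biUnion cell) = #(univ.biUnion cell) by omega
  obtain ⟨c₀, hc₀⟩ : ∃ c, x ≤ #(cell c) := by
    by_contra! hall
    have hx0 : 0 < x := by
      rcases isEmpty_or_nonempty κ with h | ⟨⟨c⟩⟩
      · simp at hk
      · exact lt_of_le_of_lt (Nat.cast_nonneg _) (hall c)
    -- Adding cells one at a time cannot jump over the window from `x` to `2x`: a union that first
    -- reaches `x` would be below `2x` and leave more than `x` outside.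
    have : ∀ 𝒞 : Finset κ, (#(𝒞.biUnion cell) : ℝ) < x := by
      intro 𝒞
      induction 𝒞 using Finset.induction with
      | empty => simpa using hx0
      | insert c 𝒞 hc ih =>
        by_contra! hge
        refine hnot _ hge ?_
        have e1 := hTr (insert c 𝒞)
        have e2 : #((insert c 𝒞).biUnion cell) ≤ #(cell c) + #(𝒞.biUnion cell) := by
          rw [biUnion_insert]; exact card_union_le _ _
        have e3 : (#((insert c 𝒞).biUnion cell) : ℝ) ≤ #(cell c) + #(𝒞.biUnion cell) := by
          exact_mod_cast e2
        have := hall c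
        linarith
    have := this univ
    linarith
  have hU : (#(({c₀} : Finset κ)ᶜ.biUnion cell) : ℝ) < x := by
    by_contra! hge
    exact hnot {c₀} (by simpa using hc₀) hge
  have e1 := h1 _ hU
  have e2 := hcard ({c₀} : Finset κ)ᶜ
  rw [card_compl, card_singleton] at e2
  have e3 : G.outerBoundary (({c₀} : Finset κ)ᶜ.biUnion cell) ⊆ S := by
    intro v hv
    obtain ⟨hv1, u, hu, huv⟩ := mem_outerBoundary.1 hv
    by_contra hvS
    obtain ⟨d, hd⟩ := hcov v hvS
    obtain ⟨c, hc, huc⟩ := mem_biUnion.1 hu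
    exact hv1 (mem_biUnion.2 ⟨c, hc, hadj c d u huc v hd huv ▸ hd⟩)
  have := card_le_card e3
  omega

/-- By Tutte, the obstruction is a set whose removal leaves more odd components than it has
vertices; for an even number of vertices parity raises the excess to two, which
`card_cells_le_of_expander` forbids. -/
theorem exists_isPerfectMatching_of_expander {x : ℝ} (hV : Even (Fintype.card V))
    (h1 : ∀ A : Finset V, (#A : ℝ) < x → #A ≤ #(G.outerBoundary A))
    (h2 : ∀ A B : Finset V, Disjoint A B → x ≤ #A → x ≤ #B → ∃ a ∈ A, ∃ b ∈ B, G.Adj a b)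
    (h6 : 6 * x ≤ Fintype.card V) : ∃ M : G.Subgraph, M.IsPerfectMatching := by
  classical
  rw [tutte]
  intro s hs
  unfold IsTutteViolator at hs
  set H := ((⊤ : G.Subgraph).deleteVerts s).coe with hH
  have hmemv : ∀ v : V, v ∈ ((⊤ : G.Subgraph).deleteVerts s).verts ↔ v ∉ s := by simp
  have : Fintype H.ConnectedComponent := Fintype.ofFinite _
  have hodd := odd_ncard_oddComponents (G := H)
  have hcv : Nat.card ((⊤ : G.Subgraph).deleteVerts s).verts + s.ncard = Fintype.card V := by
    rw [Nat.card_coe_set_eq, Subgraph.deleteVerts_verts, Subgraph.verts_top,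
      ← Nat.card_eq_fintype_card, ← Set.ncard_univ]
    exact Set.ncard_sdiff_add_ncard_of_subset (Set.subset_univ s)
  have hge : s.ncard + 2 ≤ H.oddComponents.ncard := by
    rcases Nat.lt_or_ge (s.ncard + 1) H.oddComponents.ncard with h | h
    · exact h
    · exfalso
      have he : H.oddComponents.ncard = s.ncard + 1 := by omega
      rw [he, ← Nat.not_even_iff_odd, ← Nat.not_even_iff_odd, not_iff_not] at hodd
      rw [← hcv] at hV
      rw [Nat.even_add, ← hodd, Nat.even_add_one] at hV
      tauto
  have hle : H.oddComponents.ncard ≤ Fintype.card H.ConnectedComponent := by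
    rw [← Nat.card_eq_fintype_card]
    exact Set.ncard_le_card _
  have hadj : ∀ u v (hu : u ∉ s) (hv : v ∉ s), G.Adj u v →
      H.Adj ⟨u, (hmemv u).2 hu⟩ ⟨v, (hmemv v).2 hv⟩ := by
    intro u v hu hv huv
    simp [hH, hu, hv, huv]
  have key := card_cells_le_of_expander h1 h2 h6 s.toFinset
    (fun c : H.ConnectedComponent => univ.filter fun v => ∃ hv : v ∉ s,
      H.connectedComponentMk ⟨v, (hmemv v).2 hv⟩ = c) ?_ ?_ ?_ ?_ ?_
  · rw [← Set.ncard_eq_toFinset_card'] at key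
    omega
  · intro c
    induction c using ConnectedComponent.ind with
    | h v => exact ⟨v.1, by simpa using (hmemv v.1).1 v.2⟩
  · intro c v hv
    simp only [mem_filter, mem_univ, true_and] at hv
    simpa using hv.1
  · intro c d v hc hd
    simp only [mem_filter, mem_univ, true_and] at hc hd
    obtain ⟨hv, rfl⟩ := hc
    exact hd.2
  · intro v hv
    rw [Set.mem_toFinset] at hv
    exact ⟨H.connectedComponentMk ⟨v, (hmemv v).2 hv⟩, by simp [hv]⟩
  · intro c d u hu v hv huv
    simp only [mem_filter, mem_univ, true_and] at hu hv
    obtain ⟨hu, rfl⟩ := hu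
    obtain ⟨hv, rfl⟩ := hv
    exact ConnectedComponent.connectedComponentMk_eq_of_adj (hadj u v hu hv huv)

open Classical in
theorem Subgraph.IsMatching.ncard_verts {M : G.Subgraph} (hM : M.IsMatching) :
    M.verts.ncard = 2 * M.edgeSet.ncard := by
  have h := M.spanningCoe.sum_degrees_eq_twice_card_edges
  rw [← Set.ncard_coe_finset, coe_edgeFinset, Subgraph.edgeSet_spanningCoe] at h
  rw [← h, Set.ncard_eq_toFinset_card', card_eq_sum_ones, ← sum_subset (subset_univ M.verts.toFinset)]
  · refine sum_congr rfl fun v hv => ?_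
    rw [Set.mem_toFinset] at hv
    obtain ⟨w, hw, hu⟩ := hM hv
    rw [eq_comm, ← card_neighborFinset_eq_degree, card_eq_one]
    refine ⟨w, ?_⟩
    ext u
    simp only [mem_neighborFinset, Subgraph.spanningCoe_adj, mem_singleton]
    exact ⟨fun h => hu u h, fun h => h ▸ hw⟩
  · intro v _ hv
    rw [Set.mem_toFinset] at hv
    rw [← card_neighborFinset_eq_degree, card_eq_zero]
    ext u
    simp only [mem_neighborFinset, Subgraph.spanningCoe_adj, notMem_empty, iff_false]
    exact fun h => hv (M.edge_vert h)

theorem mem_perfMatch_of_isPerfectMatching {M : G.Subgraph} (hM : M.IsPerfectMatching) :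
    G ∈ GraphGame.perfMatch V := by
  refine ⟨M, hM.1, ?_⟩
  have := hM.1.ncard_verts
  rw [hM.2.verts_eq_univ, Set.ncard_univ, Nat.card_eq_fintype_card] at this
  omega

theorem exists_adj_of_mem_perfMatch (hV : Even (Fintype.card V)) (hG : G ∈ GraphGame.perfMatch V)
    (v : V) : ∃ w, G.Adj v w := by
  obtain ⟨M, hM, hc⟩ := hG
  have h1 := hM.ncard_verts
  have h2 : M.verts = Set.univ := by
    apply Set.eq_of_subset_of_ncard_le (Set.subset_univ _)
    rw [Set.ncard_univ, Nat.card_eq_fintype_card, h1, hc]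
    obtain ⟨k, hk⟩ := hV
    omega
  obtain ⟨w, hw, -⟩ := hM (h2 ▸ Set.mem_univ v)
  exact ⟨w, hw.adj_sub⟩

end SimpleGraph

/-! ### Incident edges and expansion -/

namespace SimpleGraph

open Finset

variable {V : Type*}

open Classical in
/-- Half of the degree can be reserved at every vertex, with distinct edges for distinct vertices:
here `2 * d` edges towards `R` at every vertex of `L` that has at least `4 * d` neighbours in `R`. -/
theorem exists_injective_incident_edges (W : SimpleGraph V) (R L : Finset V) (d : ℕ)
    (h : ∀ v ∈ L, 4 * d ≤ #{w ∈ R | W.Adj v w}) :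
    ∃ g : (L × Fin d) × Bool → Sym2 V, Function.Injective g ∧
      ∀ (v : L) i c, ∃ w ∈ R, W.Adj v w ∧ g ((v, i), c) = s(v.1, w) := by
  set T : V → Finset (Sym2 V) := fun v => image (fun w => s(v, w)) {w ∈ R | W.Adj v w} with hT
  have hTcard : ∀ v, #(T v) = #{w ∈ R | W.Adj v w} := fun v =>
    card_image_of_injective _ fun a b hab => Sym2.congr_right.1 hab
  have hmem : ∀ e v, e ∈ T v → v ∈ e := by
    intro e v he
    obtain ⟨w, -, rfl⟩ := mem_image.1 he
    exact Sym2.mem_mk_left v w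
  obtain ⟨g, hg, hg'⟩ := (Finset.all_card_le_biUnion_card_iff_exists_injective
    -- Hall's condition by double counting: a set of demands at the vertices of `U` has at most `2d
    -- · #U` members, while the sets `T v` have at least `4d` edges each and every edge lies in at
    -- most two of them.
    (fun x : (L × Fin d) × Bool => T x.1.1)).1 (by
      intro s
      set U : Finset V := s.image fun x => (x.1.1 : V) with hU
      have hUL : U ⊆ L := by
        intro v hv
        obtain ⟨x, -, rfl⟩ := mem_image.1 hv
        exact x.1.1.2
      have e1 : #s ≤ 2 * d * #U := by
        refine card_le_mul_card_image s (2 * d) fun v hv => ?_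
        obtain ⟨x, -, rfl⟩ := mem_image.1 hv
        calc #{y ∈ s | (y.1.1 : V) = x.1.1} ≤ #(univ : Finset (Fin d × Bool)) := by
              refine card_le_card_of_injOn (fun y => (y.1.2, y.2)) (by simp) ?_
              rintro ⟨⟨y, i⟩, c⟩ hy ⟨⟨z, j⟩, c'⟩ hz hyz
              simp only [coe_filter, Set.mem_ofPred_eq] at hy hz
              simp only [Prod.mk.injEq] at hyz
              have : y = z := Subtype.ext (hy.2.trans hz.2.symm)
              rw [this, hyz.1, hyz.2]
          _ = 2 * d := by simp [mul_comm]
      have e2 : s.biUnion (fun x => T x.1.1) = U.biUnion T := by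
        ext e; simp [hU]
      have e3 : ∑ v ∈ U, #(T v) ≤ 2 * #(U.biUnion T) := by
        have e4 : ∀ v ∈ U, #(T v) = #{e ∈ U.biUnion T | e ∈ T v} := fun v hv => by
          congr 1
          ext e
          simp only [mem_filter, mem_biUnion]
          exact ⟨fun he => ⟨⟨v, hv, he⟩, he⟩, fun he => he.2⟩
        rw [sum_congr rfl e4]
        have := sum_card_bipartiteAbove_eq_sum_card_bipartiteBelow (s := U) (t := U.biUnion T)
          (fun v e => e ∈ T v)
        simp only [bipartiteAbove, bipartiteBelow] at this
        rw [this, mul_comm, ← smul_eq_mul, ← sum_const]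
        refine sum_le_sum fun e _ => ?_
        induction e using Sym2.ind with
        | _ a b =>
        calc #{v ∈ U | s(a, b) ∈ T v} ≤ #{a, b} := by
              refine card_le_card fun v hv => ?_
              have := hmem _ _ (mem_filter.1 hv).2
              simpa using this
          _ ≤ 2 := card_le_two
      have e5 : 4 * d * #U ≤ ∑ v ∈ U, #(T v) := by
        rw [mul_comm, ← smul_eq_mul, ← sum_const]
        exact sum_le_sum fun v hv => (h v (hUL hv)).trans (hTcard v).ge
      rw [e2]
      nlinarith)
  refine ⟨g, hg, fun v i c => ?_⟩
  obtain ⟨w, hw, he⟩ := mem_image.1 (hg' ((v, i), c))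
  exact ⟨w, (mem_filter.1 hw).1, (mem_filter.1 hw).2, he.symm⟩

variable [Fintype V]

open Classical in
/-- The edges of `G` with both ends in `U`. -/
noncomputable def edgesWithin (G : SimpleGraph V) (U : Finset V) : Finset (Sym2 V) :=
  {e | e ∈ G.edgeSet ∧ ∀ v ∈ e, v ∈ U}

theorem mem_edgesWithin {G : SimpleGraph V} {U : Finset V} {e : Sym2 V} :
    e ∈ G.edgesWithin U ↔ e ∈ G.edgeSet ∧ ∀ v ∈ e, v ∈ U := by
  simp [edgesWithin]

open Classical in
/-- If the vertices of `S` each have a private neighbour in `D`, those outside `S` each own `d`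
private edges to the complement of `D`, and small sets are locally sparse, then small sets
expand. -/
theorem card_le_card_outerBoundary {M : SimpleGraph V} {S D : Finset V} {d : ℕ} (hd : 0 < d)
    {x : ℝ} (hSD : S ⊆ D) (f : V → V) (hf : ∀ s ∈ S, M.Adj s (f s) ∧ f s ∈ D ∧ f s ∉ S)
    (hfi : Set.InjOn f S)
    (g : V → Fin d → V) (hg : ∀ v ∉ S, ∀ i, M.Adj v (g v i) ∧ g v i ∉ D)
    (hgi : ∀ v ∉ S, ∀ i, ∀ w ∉ S, ∀ j, s(v, g v i) = s(w, g w j) → v = w ∧ i = j)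
    (hsp : ∀ U : Finset V, (#U : ℝ) < 3 * x →
      3 * #(M.edgesWithin U) ≤ d * #U)
    (A : Finset V) (hA : (#A : ℝ) < x) : #A ≤ #(M.outerBoundary A) := by
  set As := A.filter (· ∈ S) with hAs
  set Al := A.filter (· ∉ S) with hAl
  have hAA : #As + #Al = #A := card_filter_add_card_filter_not _
  set N := (Al ×ˢ (univ : Finset (Fin d))).image (fun p => g p.1 p.2) with hN
  set Y := N \ Al with hY
  set U := Al ∪ Y with hU
  have hAlA : #Al ≤ #A := card_filter_le _ _
  have hgU : ∀ v ∈ Al, ∀ i, g v i ∈ U := fun v hv i => by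
    by_cases h : g v i ∈ Al
    · exact mem_union_left _ h
    · exact mem_union_right _ (mem_sdiff.2 ⟨mem_image.2 ⟨(v, i), by simp [hv], rfl⟩, h⟩)
  -- Otherwise `U` has fewer than `3 * #Al` vertices but contains the `d * #Al` private edges,
  -- against local sparsity.
  have hY2 : 2 * #Al ≤ #Y := by
    by_contra! hlt
    have hUc : #U < 3 * #Al := (card_union_le _ _).trans_lt (by omega)
    have hU3 : (#U : ℝ) < 3 * x := by
      have h1 : (#U : ℝ) < 3 * #Al := by exact_mod_cast hUc
      have h2 : (#Al : ℝ) ≤ #A := by exact_mod_cast hAlA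
      linarith
    have h1 := hsp U hU3
    have h2 : #Al * d ≤ #(M.edgesWithin U) := by
      calc #Al * d = #(Al ×ˢ (univ : Finset (Fin d))) := by simp
        _ ≤ _ := by
          refine card_le_card_of_injOn (fun p => s(p.1, g p.1 p.2)) ?_ ?_
          · rintro ⟨v, i⟩ hv
            simp only [coe_product, coe_univ, Set.mem_prod, mem_coe, Set.mem_univ, and_true] at hv
            rw [mem_coe, mem_edgesWithin]
            refine ⟨(hg v (mem_filter.1 hv).2 i).1, fun w hw => ?_⟩
            rcases Sym2.mem_iff.1 hw with rfl | rfl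
            · exact mem_union_left _ hv
            · exact hgU v hv i
          · rintro ⟨v, i⟩ hv ⟨w, j⟩ hw hvw
            simp only [coe_product, coe_univ, Set.mem_prod, mem_coe, Set.mem_univ, and_true]
              at hv hw
            have := hgi v (mem_filter.1 hv).2 i w (mem_filter.1 hw).2 j hvw
            rw [this.1, this.2]
    have h3 : d * #U < d * (3 * #Al) := Nat.mul_lt_mul_of_pos_left hUc hd
    nlinarith
  set X := As.image f with hX
  have hXc : #X = #As := card_image_of_injOn fun a ha b hb hab =>
    hfi (mem_filter.1 ha).2 (mem_filter.1 hb).2 hab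
  -- The private neighbours of `As` may fall into `Al`, a loss of at most `#Al`. The surplus in
  -- `hY2` pays for it: `(#As - #Al) + 2 * #Al = #A`, and `X`, inside `D`, does not meet `Y`,
  -- outside `D`.
  have hXs : #As - #Al ≤ #(X \ Al) := hXc ▸ le_card_sdiff _ _
  have hYD : ∀ y ∈ Y, y ∉ D := fun y hy => by
    obtain ⟨⟨v, i⟩, hv, rfl⟩ := mem_image.1 (mem_sdiff.1 hy).1
    exact (hg v (mem_filter.1 (mem_product.1 hv).1).2 i).2
  have hdisj : Disjoint (X \ Al) Y := by
    rw [Finset.disjoint_left]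
    intro v hv hvY
    obtain ⟨s, hs, rfl⟩ := mem_image.1 (mem_sdiff.1 hv).1
    exact hYD _ hvY (hf s (mem_filter.1 hs).2).2.1
  have hsub : (X \ Al) ∪ Y ⊆ M.outerBoundary A := by
    intro v hv
    rw [mem_outerBoundary]
    rcases mem_union.1 hv with hv | hv
    · obtain ⟨s, hs, rfl⟩ := mem_image.1 (mem_sdiff.1 hv).1
      have := hf s (mem_filter.1 hs).2
      exact ⟨fun h => (mem_sdiff.1 hv).2 (mem_filter.2 ⟨h, this.2.2⟩), s, (mem_filter.1 hs).1, this.1⟩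
    · have hvS : v ∉ S := fun h => hYD v hv (hSD h)
      obtain ⟨⟨w, i⟩, hw, rfl⟩ := mem_image.1 (mem_sdiff.1 hv).1
      have hw' := mem_filter.1 (mem_product.1 hw).1
      exact ⟨fun h => (mem_sdiff.1 hv).2 (mem_filter.2 ⟨h, hvS⟩), w, hw'.1, (hg w hw'.2 i).1⟩
  have := card_le_card hsub
  rw [card_union_of_disjoint hdisj] at this
  omega

end SimpleGraph

/-! ### The perfect matching game -/

namespace GraphGame

open Finset SimpleGraph PositionalGame

variable {V : Type*} [Fintype V]

open Classical in
/-- A perfect matching needs two edges at every vertex, or else Breaker isolates a vertex. -/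
theorem two_le_degree_of_makersWin (hV : Even (Fintype.card V)) [Nonempty V] {G : SimpleGraph V}
    (hG : G ∈ makersWin (perfMatch V)) : G ∈ minDegreeAtLeast V 2 := by
  obtain ⟨μ, hμ⟩ := hG
  change 2 ≤ G.minDegree
  refine G.le_minDegree_of_forall_le_degree _ fun v => ?_
  by_contra! hv
  obtain ⟨e, he⟩ : ∃ e : Sym2 V, ∀ w, G.Adj v w → s(v, w) = e := by
    by_cases h : ∃ w, G.Adj v w
    · obtain ⟨w, hw⟩ := h
      refine ⟨s(v, w), fun u hu => ?_⟩
      have : u = w := card_le_one.1 (by rw [card_neighborFinset_eq_degree]; omega) u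
        ((G.mem_neighborFinset v u).2 hu) w ((G.mem_neighborFinset v w).2 hw)
      rw [this]
    -- At an isolated vertex any `e` will do; the loop `s(v, v)` is never on the board.
    · push Not at h
      exact ⟨s(v, v), fun w hw => absurd hw (h w)⟩
  obtain ⟨A, ⟨hA1, hA2⟩, hA3⟩ := hμ (claimFirst G.edgeFinset e)
  obtain ⟨w, hw⟩ := exists_adj_of_mem_perfMatch hV hA2 v
  rw [fromEdgeSet_adj] at hw
  have := he w (hA1 hw.1)
  exact notMem_makerClaims_claimFirst μ e (hA3 (this ▸ hw.1))

/-- Two vertices of `S` are at distance more than four in `H`. -/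
def FarApart (H : SimpleGraph V) (S : Finset V) : Prop :=
  ∀ u ∈ S, ∀ w ∈ S, ∀ p : H.Walk u w, p.length ≤ 4 → u = w

open Classical in
/-- Maker wins the perfect matching game by a pairing strategy, if the vertices of low degree in
`W` are few and far apart, small sets are locally sparse, and some edges outside `W` are paired
such that every two large sets are joined by both edges of some pair. -/
theorem mem_makersWin_perfMatch (hV : Even (Fintype.card V)) {G H W : SimpleGraph V}
    (hGH : G ≤ H) (hWG : W ≤ G) {S : Finset V} {d : ℕ} (hd : 0 < d) {x : ℝ}
    (h6 : 6 * x ≤ Fintype.card V) (hS : 2 * (#S : ℝ) ≤ x) (hdeg : G ∈ minDegreeAtLeast V 2)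
    (hfar : FarApart H S) (hlarge : ∀ v ∉ S, 4 * d + 3 ≤ #{w | W.Adj v w})
    (hsp : ∀ U : Finset V, (#U : ℝ) < 3 * x →
      3 * #(H.edgesWithin U) ≤ d * #U)
    {κ : Type*} (p : κ × Bool → Sym2 V) (hp : Function.Injective p)
    (hpG : ∀ i, p i ∈ G.edgeSet) (hpW : ∀ i, p i ∉ W.edgeSet)
    (hpair : ∀ A B : Finset V, Disjoint A B → x ≤ 2 * #A → x ≤ 2 * #B →
      ∃ i, ∀ c, ∃ a ∈ A, ∃ b ∈ B, p (i, c) = s(a, b)) :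
    G ∈ makersWin (perfMatch V) := by
  have hnb : ∀ s : V, ∃ q : Bool → V, (∀ c, G.Adj s (q c)) ∧ q false ≠ q true := by
    intro s
    have h1 : 2 ≤ G.degree s := le_trans hdeg (G.minDegree_le_degree s)
    rw [← card_neighborFinset_eq_degree] at h1
    obtain ⟨a, b, ha, hb, hab⟩ := one_lt_card_iff.1 h1
    rw [mem_neighborFinset] at ha hb
    refine ⟨fun c => if c then b else a, fun c => ?_, by simpa using hab⟩
    cases c <;> simpa
  choose q hqadj hqne using hnb
  have hqinj : ∀ s c c', q s c = q s c' → c = c' := by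
    intro s c c' h
    cases c <;> cases c' <;> first | rfl | exact absurd h (hqne s) | exact absurd h.symm (hqne s)
  have hH : ∀ s c, H.Adj s (q s c) := fun s c => hGH (hqadj s c)
  have hqS : ∀ s ∈ S, ∀ c, q s c ∉ S := fun s hs c hc =>
    (hqadj s c).ne (hfar s hs _ hc (hH s c).toWalk (by simp))
  have hqq : ∀ s ∈ S, ∀ s' ∈ S, ∀ c c', q s c = q s' c' → s = s' := fun s hs s' hs' c c' h =>
    hfar s hs s' hs' (Walk.cons (hH s c) (Walk.cons (h ▸ (hH s' c').symm) Walk.nil)) (by simp)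
  -- The zone reserved for `S`; edges of the second kind must end outside it, so that the two sorts
  -- of private neighbours stay disjoint.
  set D : Finset V := S ∪ (S ×ˢ (univ : Finset Bool)).image (fun y => q y.1 y.2) with hD
  have hDmem : ∀ {v}, v ∈ D ↔ v ∈ S ∨ ∃ s ∈ S, ∃ c, q s c = v := by
    intro v
    simp only [hD, mem_union, mem_image, mem_product, mem_univ, and_true, Prod.exists]
    simp only [exists_and_left]
  have hDwalk : ∀ v ∈ D, ∃ s ∈ S, (v = s ∨ ∃ c, v = q s c) ∧ ∃ r : H.Walk s v, r.length ≤ 1 := by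
    intro v hv
    rcases hDmem.1 hv with h | ⟨s, hs, c, rfl⟩
    · exact ⟨v, h, .inl rfl, Walk.nil, by simp⟩
    · exact ⟨s, hs, .inr ⟨c, rfl⟩, (hH s c).toWalk, by simp⟩
  -- Two neighbours of `v` in `D` stem from vertices of `S` at distance at most `1 + 2 + 1 = 4`,
  -- hence from the same `s`. This is where distance four is needed, and it accounts for the `+ 3`
  -- in `hlarge`.
  have hDdeg : ∀ v, #{w ∈ D | W.Adj v w} ≤ 3 := by
    intro v
    rcases ({w ∈ D | W.Adj v w} : Finset V).eq_empty_or_nonempty with h | ⟨w, hw⟩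
    · simp [h]
    · rw [mem_filter] at hw
      obtain ⟨s, hs, -, r, hr⟩ := hDwalk w hw.1
      calc #{w ∈ D | W.Adj v w} ≤ #{s, q s false, q s true} := by
            refine card_le_card fun u hu => ?_
            rw [mem_filter] at hu
            obtain ⟨s', hs', hu', r', hr'⟩ := hDwalk u hu.1
            have e1 : H.Adj w v := hGH (hWG hw.2.symm)
            have e2 : H.Adj v u := hGH (hWG hu.2)
            have : s = s' := hfar s hs s' hs' (r.append (Walk.cons e1 (Walk.cons e2 r'.reverse)))
              (by simp only [Walk.length_append, Walk.length_cons, Walk.length_reverse]; omega)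
            subst this
            simp only [mem_insert, mem_singleton]
            rcases hu' with h | ⟨c, h⟩
            · exact .inl h
            · cases c
              · exact .inr (.inl h)
              · exact .inr (.inr h)
        _ ≤ 3 := card_le_three
  obtain ⟨g, hg, hg'⟩ := exists_injective_incident_edges W Dᶜ Sᶜ d (by
    intro v hv
    rw [mem_compl] at hv
    have h1 := hlarge v hv
    have h2 := hDdeg v
    have h3 : #{w | W.Adj v w} = #{w ∈ D | W.Adj v w} + #{w ∈ Dᶜ | W.Adj v w} := by
      rw [← card_union_of_disjoint, ← filter_union, union_compl]
      exact disjoint_filter_filter disjoint_compl_right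
    omega)
  have hSD : S ⊆ D := subset_union_left
  have hgW : ∀ y, g y ∈ W.edgeSet := by
    rintro ⟨⟨v, i⟩, c⟩
    obtain ⟨w, -, hw, he⟩ := hg' v i c
    rw [he]; exact hw
  have hgS : ∀ y, ∀ s ∈ S, s ∉ g y := by
    rintro ⟨⟨v, i⟩, c⟩ s hs hsg
    obtain ⟨w, hw, -, he⟩ := hg' v i c
    rw [he] at hsg
    rcases Sym2.mem_iff.1 hsg with rfl | rfl
    · exact mem_compl.1 v.2 hs
    · exact mem_compl.1 hw (hSD hs)
  -- Pairs touching `S` could overlap the first kind and are dropped. Nothing is lost: the joining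
  -- property will be applied to `A \ S` and `B \ S`, which keep at least `x / 2` vertices.
  let κ' := {i : κ // ∀ c, ∀ s ∈ S, s ∉ p (i, c)}
  let F : (S ⊕ (((Sᶜ : Finset V) × Fin d) ⊕ κ')) × Bool → Sym2 V := fun y =>
    match y with
    | (.inl s, c) => s(s.1, q s.1 c)
    | (.inr (.inl z), c) => g (z, c)
    | (.inr (.inr i), c) => p (i.1, c)
  have hF : Function.Injective F := by
    rintro ⟨s | z | i, c⟩ ⟨s' | z' | i', c'⟩ h <;> simp only [F] at h
    · have hs : s.1 = s'.1 := by
        have : s.1 ∈ s(s'.1, q s'.1 c') := h ▸ Sym2.mem_mk_left _ _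
        rcases Sym2.mem_iff.1 this with h | h
        · exact h
        · exact absurd (h ▸ s.2) (hqS s'.1 s'.2 c')
      have hss : s = s' := Subtype.ext hs
      subst hss
      rw [hqinj _ _ _ (Sym2.congr_right.1 h)]
    · exact absurd (h ▸ Sym2.mem_mk_left _ _) (hgS (z', c') s.1 s.2)
    · exact absurd (h ▸ Sym2.mem_mk_left _ _) (i'.2 c' s.1 s.2)
    · exact absurd (h ▸ Sym2.mem_mk_left _ _) (hgS (z, c) s'.1 s'.2)
    · have := hg h
      simp only [Prod.mk.injEq] at this
      simp [this.1, this.2]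
    · exact absurd (h ▸ hgW (z, c)) (hpW (i'.1, c'))
    · exact absurd (h ▸ Sym2.mem_mk_left _ _) (i.2 c s'.1 s'.2)
    · exact absurd (h.symm ▸ hgW (z', c')) (hpW (i.1, c))
    · have := hp h
      simp only [Prod.mk.injEq] at this
      have hii : i = i' := Subtype.ext this.1
      rw [hii, this.2]
  have hFG : ∀ y, F y ∈ G.edgeFinset := by
    rintro ⟨s | z | i, c⟩ <;> rw [mem_edgeFinset]
    · exact hqadj s.1 c
    · exact edgeSet_mono hWG (hgW (z, c))
    · exact hpG (i.1, c)
  refine ⟨pairingStrategy G.edgeFinset F, fun β => ?_⟩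
  have hcl := pairingStrategy_claims hF hFG β
  set C := makerClaims (play β (pairingStrategy G.edgeFinset F) G.edgeFinset.card) with hC
  have hCG : C ⊆ G.edgeSet := fun e he =>
    mem_edgeFinset.1 (makerClaims_subset β (pairingStrategy G.edgeFinset F) he)
  refine ⟨C, ⟨hCG, ?_⟩, subset_rfl⟩
  have hMG : fromEdgeSet C ≤ G := by
    intro u v huv
    exact hCG ((fromEdgeSet_adj C).1 huv).1
  have hadj : ∀ u v, s(u, v) ∈ C → (fromEdgeSet C).Adj u v := fun u v h =>
    (fromEdgeSet_adj C).2 ⟨h, (show G.Adj u v from hCG h).ne⟩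
  choose cl hcl using hcl
  suffices h : ∃ M : (fromEdgeSet C).Subgraph, M.IsPerfectMatching by
    obtain ⟨M, hM⟩ := h
    exact mem_perfMatch_of_isPerfectMatching hM
  refine exists_isPerfectMatching_of_expander (x := x) hV ?_ ?_ h6
  -- The selected neighbours are made total functions; the values of `k` on `S` and of `f` off `S`
  -- are irrelevant.
  · have hsel : ∀ (v : V) (i : Fin d), ∃ w, ∀ hv : v ∉ S, w ∉ D ∧
        F (.inr (.inl (⟨v, mem_compl.2 hv⟩, i)), cl (.inr (.inl (⟨v, mem_compl.2 hv⟩, i)))) =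
          s(v, w) := by
      intro v i
      by_cases hv : v ∈ S
      · exact ⟨v, fun h => absurd hv h⟩
      · obtain ⟨w, hw, -, he⟩ := hg' ⟨v, mem_compl.2 hv⟩ i
          (cl (.inr (.inl (⟨v, mem_compl.2 hv⟩, i))))
        exact ⟨w, fun _ => ⟨mem_compl.1 hw, he⟩⟩
    choose k hk using hsel
    let f : V → V := fun s => if hs : s ∈ S then q s (cl (.inl ⟨s, hs⟩)) else s
    have hfS : ∀ s (hs : s ∈ S), f s = q s (cl (.inl ⟨s, hs⟩)) := fun s hs => by simp [f, hs]
    refine card_le_card_outerBoundary (S := S) (D := D) hd hSD f ?_ ?_ k ?_ ?_ ?_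
    · intro s hs
      rw [hfS s hs]
      refine ⟨hadj _ _ (hcl (.inl ⟨s, hs⟩)), hDmem.2 (.inr ⟨s, hs, _, rfl⟩), hqS s hs _⟩
    · intro s hs s' hs' h
      rw [hfS s hs, hfS s' hs'] at h
      exact hqq s hs s' hs' _ _ h
    · intro v hv i
      obtain ⟨h1, h2⟩ := hk v i hv
      exact ⟨hadj _ _ (h2 ▸ hcl (.inr (.inl (⟨v, mem_compl.2 hv⟩, i)))), h1⟩
    · intro v hv i w hw j h
      rw [← (hk v i hv).2, ← (hk w j hw).2] at h
      have := @hF (.inr (.inl (⟨v, mem_compl.2 hv⟩, i)), _)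
        (.inr (.inl (⟨w, mem_compl.2 hw⟩, j)), _) h
      simp only [Prod.mk.injEq, Sum.inr.injEq, Sum.inl.injEq, Subtype.mk.injEq] at this
      exact this.1
    · intro U hU
      refine le_trans (Nat.mul_le_mul_left 3 (card_le_card ?_)) (hsp U hU)
      intro e he
      rw [mem_edgesWithin] at he ⊢
      exact ⟨edgeSet_mono (hMG.trans hGH) he.1, he.2⟩
  · intro A B hAB hA hB
    have hbig : ∀ A : Finset V, x ≤ #A → x ≤ 2 * (#(A \ S) : ℝ) := fun A hA => by
      have h1 : #A ≤ #(A \ S) + #S := by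
        have := le_card_sdiff S A
        omega
      have h2 : (#A : ℝ) ≤ #(A \ S) + #S := by exact_mod_cast h1
      linarith
    obtain ⟨i, hi⟩ := hpair (A \ S) (B \ S)
      (hAB.mono sdiff_subset sdiff_subset) (hbig A hA) (hbig B hB)
    have hi' : ∀ c, ∀ s ∈ S, s ∉ p (i, c) := by
      intro c s hs hsp
      obtain ⟨a, ha, b, hb, he⟩ := hi c
      rw [he] at hsp
      rcases Sym2.mem_iff.1 hsp with rfl | rfl
      · exact (mem_sdiff.1 ha).2 hs
      · exact (mem_sdiff.1 hb).2 hs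
    obtain ⟨a, ha, b, hb, he⟩ := hi (cl (.inr (.inr ⟨i, hi'⟩)))
    refine ⟨a, (mem_sdiff.1 ha).1, b, (mem_sdiff.1 hb).1, hadj _ _ ?_⟩
    rw [← he]
    exact hcl (.inr (.inr ⟨i, hi'⟩))

end GraphGame

/-! ### Windows of the random graph process -/

namespace GraphProcess

open Finset SimpleGraph

variable {n : ℕ}

/-- The pairs of distinct vertices. -/
abbrev Pair (n : ℕ) : Type := {e : Sym2 (Fin n) // ¬ e.IsDiag}

/-- The pair of two distinct vertices. -/
def mkPair (u v : Fin n) (h : u ≠ v) : Pair n := ⟨s(u, v), by simpa using h⟩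

/-- The positions from `a` to `b - 1`. -/
def window (n a b : ℕ) : Finset (Fin (n.choose 2)) := {t | a ≤ (t : ℕ) ∧ (t : ℕ) < b}

theorem mem_window {a b : ℕ} {t : Fin (n.choose 2)} :
    t ∈ window n a b ↔ a ≤ (t : ℕ) ∧ (t : ℕ) < b := by
  simp [window]

theorem card_window {a b : ℕ} (hb : b ≤ n.choose 2) : #(window n a b) = b - a := by
  rw [← Nat.card_Ico]
  refine card_bij (fun t _ => (t : ℕ)) (fun t ht => ?_) (fun s _ t _ h => Fin.ext h) fun k hk => ?_
  · rw [mem_window] at ht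
    simpa using ht
  · rw [mem_Ico] at hk
    exact ⟨⟨k, hk.2.trans_le hb⟩, by simpa [mem_window] using hk, rfl⟩

/-- The graph formed by the pairs with positions from `a` to `b - 1`. -/
def windowGraph (π : PairOrdering n) (a b : ℕ) : SimpleGraph (Fin n) :=
  SimpleGraph.fromEdgeSet {e | ∃ he : ¬ e.IsDiag, π ⟨e, he⟩ ∈ window n a b}

theorem windowGraph_adj {π : PairOrdering n} {a b : ℕ} {u v : Fin n} :
    (windowGraph π a b).Adj u v ↔ ∃ h : u ≠ v, π (mkPair u v h) ∈ window n a b := by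
  rw [windowGraph, fromEdgeSet_adj]
  constructor
  · rintro ⟨⟨he, h⟩, huv⟩
    exact ⟨huv, h⟩
  · rintro ⟨huv, h⟩
    exact ⟨⟨_, h⟩, huv⟩

theorem graphAt_eq (π : PairOrdering n) (t : ℕ) : graphAt π t = windowGraph π 0 t := by
  simp [graphAt, windowGraph, mem_window]

theorem windowGraph_mono (π : PairOrdering n) {a b a' b' : ℕ} (ha : a' ≤ a) (hb : b ≤ b') :
    windowGraph π a b ≤ windowGraph π a' b' := by
  intro u v h
  rw [windowGraph_adj] at h ⊢
  obtain ⟨huv, h⟩ := h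
  rw [mem_window] at h
  exact ⟨huv, mem_window.2 ⟨ha.trans h.1, h.2.trans_le hb⟩⟩

theorem mem_edgeSet_windowGraph {π : PairOrdering n} {a b : ℕ} {e : Sym2 (Fin n)} :
    e ∈ (windowGraph π a b).edgeSet ↔ ∃ he : ¬ e.IsDiag, π ⟨e, he⟩ ∈ window n a b := by
  induction e using Sym2.ind with
  | _ u v =>
    rw [mem_edgeSet, windowGraph_adj]
    simp only [mkPair, Sym2.mk_isDiag_iff, ne_eq]

/-- The pairs that contain `v`. -/
def star (v : Fin n) : Finset (Pair n) := {e | v ∈ e.1}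

theorem mem_star {v : Fin n} {e : Pair n} : e ∈ star v ↔ v ∈ e.1 := by simp [star]

theorem card_star_filter (v : Fin n) (P : Pair n → Prop) [DecidablePred P]
    [DecidablePred fun w => ∃ h : v ≠ w, P (mkPair v w h)] :
    #{e ∈ star v | P e} = #{w | ∃ h : v ≠ w, P (mkPair v w h)} := by
  symm
  refine card_bij (fun w hw => mkPair v w (mem_filter.1 hw).2.1) ?_ ?_ ?_
  · intro w hw
    rw [mem_filter, mem_star]
    exact ⟨Sym2.mem_mk_left _ _, (mem_filter.1 hw).2.2⟩
  · intro w hw w' hw' h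
    simp only [mkPair, Subtype.mk.injEq] at h
    exact Sym2.congr_right.1 h
  · rintro ⟨e, he⟩ hP
    rw [mem_filter, mem_star] at hP
    obtain ⟨w, rfl⟩ := Sym2.mem_iff_exists.1 hP.1
    have hvw : v ≠ w := by simpa using he
    exact ⟨w, by simpa using ⟨hvw, hP.2⟩, rfl⟩

theorem card_star (v : Fin n) : #(star v) = n - 1 := by
  have h := card_star_filter v (fun _ => True)
  rw [filter_true] at h
  rw [h]
  simp only [exists_prop, and_true]
  rw [filter_ne]
  simp

theorem star_inter_star {u v : Fin n} (h : u ≠ v) : star u ∩ star v = {mkPair u v h} := by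
  ext e
  rw [mem_inter, mem_star, mem_star, mem_singleton, Sym2.mem_and_mem_iff h, mkPair, Subtype.ext_iff]

theorem card_star_union_star {u v : Fin n} (h : u ≠ v) : #(star u ∪ star v) = 2 * n - 3 := by
  have h1 := card_union_add_card_inter (star u) (star v)
  rw [star_inter_star h, card_star, card_star, card_singleton] at h1
  have : 2 ≤ n := by
    by_contra! hn
    exact h (Fin.ext (by omega))
  omega

open Classical in
theorem card_windowGraph_adj (π : PairOrdering n) (a b : ℕ) (v : Fin n) :
    #{w | (windowGraph π a b).Adj v w} = #{e ∈ star v | π e ∈ window n a b} := by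
  rw [card_star_filter v (fun e => π e ∈ window n a b)]
  simp only [windowGraph_adj]

/-- The vertices incident to fewer than `r` of the pairs with positions from `a` to `b - 1`. -/
noncomputable def smallVertices (π : PairOrdering n) (a b : ℕ) (r : ℝ) : Finset (Fin n) :=
  {v | (#{e ∈ star v | π e ∈ window n a b} : ℝ) < r}

theorem mem_smallVertices {π : PairOrdering n} {a b : ℕ} {r : ℝ} {v : Fin n} :
    v ∈ smallVertices π a b r ↔ (#{e ∈ star v | π e ∈ window n a b} : ℝ) < r := by
  simp [smallVertices]

theorem prob_star_le (hn : 10 ≤ n) (v : Fin n) (a b : ℕ) (r : ℝ) :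
    prob {π : PairOrdering n | (#{e ∈ star v | π e ∈ window n a b} : ℝ) ≤ r} ≤
      Real.exp 72 * (8 : ℝ) ^ r *
        Real.exp (-(7 / 8 * (n - 1) * (#(window n a b) / (n.choose 2 : ℕ)))) := by
  have h := prob_lower_tail hn (F := ∅) (Q := star v) (disjoint_empty_left _)
    (by rw [card_star, card_empty]; omega) (window n a b) ∅ r
  rw [card_star, Nat.cast_sub (by omega)] at h
  simpa using h

/-- The lower tail is applied with the path edges as `F` and the rest of the two stars as `Q`. The
stars cover `2n - 3` pairs and at most four are path edges, whence `2n - 7`; two small ends leave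
fewer than `2s` hits in `Q`. -/
theorem prob_path_le (hn : 10 ≤ n) {r : ℕ} (hr : 1 ≤ r) (hr4 : r ≤ 4) (x : Fin (r + 1) ↪ Fin n)
    (a b m : ℕ) (s : ℝ) :
    prob {π : PairOrdering n | (∀ i : Fin r, (graphAt π m).Adj (x i.castSucc) (x i.succ)) ∧
        x 0 ∈ smallVertices π a b s ∧ x (Fin.last r) ∈ smallVertices π a b s} ≤
      Real.exp 72 * (8 : ℝ) ^ (2 * s) * ((#(window n 0 m) : ℝ) / (n.choose 2 : ℕ)) ^ r *
        Real.exp (-(7 / 8 * (2 * n - 7) * (#(window n a b) / (n.choose 2 : ℕ)))) := by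
  have hne : ∀ i : Fin r, x i.castSucc ≠ x i.succ := fun i h =>
    (Fin.castSucc_lt_succ (i := i)).ne (x.injective h)
  set F : Finset (Pair n) := univ.image fun i : Fin r => mkPair _ _ (hne i) with hF
  have hFc : #F = r := by
    rw [hF, card_image_of_injective, card_univ, Fintype.card_fin]
    intro i j hij
    simp only [mkPair, Subtype.mk.injEq, Sym2.eq_iff] at hij
    rcases hij with h | h
    · exact Fin.castSucc_injective _ (x.injective h.1)
    · have h1 := congrArg Fin.val (x.injective h.1)
      have h2 := congrArg Fin.val (x.injective h.2)
      simp at h1 h2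
      omega
  have h0l : x 0 ≠ x (Fin.last r) := fun h => by
    have := congrArg Fin.val (x.injective h)
    simp at this
    omega
  set Q := (star (x 0) ∪ star (x (Fin.last r))) \ F with hQ
  have hQ1 : #Q ≤ 2 * n - 3 := by
    rw [← card_star_union_star h0l]; exact card_le_card sdiff_subset
  have hQ2 : 2 * n - 3 ≤ #Q + r := by
    have : #(star (x 0) ∪ star (x (Fin.last r))) - #F ≤ #Q := le_card_sdiff F _
    rw [card_star_union_star h0l, hFc] at this
    omega
  have hQ3 : 2 * (n : ℝ) - 7 ≤ #Q := by
    have : 2 * n ≤ #Q + 7 := by omega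
    have : 2 * (n : ℝ) ≤ #Q + 7 := by exact_mod_cast this
    linarith
  have h := prob_lower_tail hn (F := F) (Q := Q) disjoint_sdiff (by omega) (window n a b)
    (window n 0 m) (2 * s)
  rw [hFc] at h
  refine (prob_mono ?_).trans (h.trans ?_)
  · rintro π ⟨h1, h2, h3⟩
    rw [mem_smallVertices] at h2 h3
    refine ⟨?_, ?_⟩
    · intro e he
      obtain ⟨i, -, rfl⟩ := mem_image.1 he
      have := h1 i
      rw [graphAt_eq, windowGraph_adj] at this
      exact this.2
    · have : #{e ∈ Q | π e ∈ window n a b} ≤ #{e ∈ star (x 0) | π e ∈ window n a b} +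
          #{e ∈ star (x (Fin.last r)) | π e ∈ window n a b} := by
        refine (card_le_card ?_).trans (card_union_le _ _)
        rw [← filter_union]
        exact filter_subset_filter _ sdiff_subset
      have : (#{e ∈ Q | π e ∈ window n a b} : ℝ) ≤ #{e ∈ star (x 0) | π e ∈ window n a b} +
          #{e ∈ star (x (Fin.last r)) | π e ∈ window n a b} := by exact_mod_cast this
      linarith
  · gcongr

theorem exists_path_of_not_farApart {H : SimpleGraph (Fin n)} {S : Finset (Fin n)}
    (h : ¬ GraphGame.FarApart H S) : ∃ r ∈ Icc 1 4, ∃ x : Fin (r + 1) ↪ Fin n,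
      (∀ i : Fin r, H.Adj (x i.castSucc) (x i.succ)) ∧ x 0 ∈ S ∧ x (Fin.last r) ∈ S := by
  classical
  unfold GraphGame.FarApart at h
  push Not at h
  obtain ⟨u, hu, w, hw, p, hp, huw⟩ := h
  -- Shortcutting the walk makes its vertices distinct, so the union bound may run over embeddings.
  have hq := p.bypass_isPath
  set q := p.bypass with hqdef
  have hql : q.length ≤ 4 := p.length_bypass_le_length.trans hp
  have hq1 : 1 ≤ q.length := by
    by_contra! h0
    exact huw (Walk.eq_of_length_eq_zero (by omega : q.length = 0))
  refine ⟨q.length, mem_Icc.2 ⟨hq1, hql⟩, ⟨fun i => q.getVert i, fun i j hij => ?_⟩, ?_, ?_, ?_⟩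
  · exact Fin.ext (hq.getVert_injOn (by simp; omega) (by simp; omega) hij)
  · intro i
    exact q.adj_getVert_succ i.2
  · change q.getVert 0 ∈ S
    rwa [Walk.getVert_zero]
  · change q.getVert q.length ∈ S
    rwa [Walk.getVert_length]

theorem prob_not_farApart_le (hn : 10 ≤ n) (a b m : ℕ) (s : ℝ) :
    prob {π : PairOrdering n | ¬ GraphGame.FarApart (graphAt π m) (smallVertices π a b s)} ≤
      ∑ r ∈ Icc 1 4, (n : ℝ) ^ (r + 1) * (Real.exp 72 * (8 : ℝ) ^ (2 * s) *
        ((#(window n 0 m) : ℝ) / (n.choose 2 : ℕ)) ^ r *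
        Real.exp (-(7 / 8 * (2 * n - 7) * (#(window n a b) / (n.choose 2 : ℕ))))) := by
  refine (prob_le_sum (Icc 1 4) (B := fun r => {π : PairOrdering n | ∃ x : Fin (r + 1) ↪ Fin n,
      (∀ i : Fin r, (graphAt π m).Adj (x i.castSucc) (x i.succ)) ∧
        x 0 ∈ smallVertices π a b s ∧ x (Fin.last r) ∈ smallVertices π a b s}) ?_).trans ?_
  · exact fun π hπ => exists_path_of_not_farApart hπ
  · refine sum_le_sum fun r hr => ?_
    rw [mem_Icc] at hr
    refine (prob_le_sum (univ : Finset (Fin (r + 1) ↪ Fin n)) (B := fun x => {π : PairOrdering n |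
      (∀ i : Fin r, (graphAt π m).Adj (x i.castSucc) (x i.succ)) ∧
        x 0 ∈ smallVertices π a b s ∧ x (Fin.last r) ∈ smallVertices π a b s}) ?_).trans ?_
    · rintro π ⟨x, hx⟩
      exact ⟨x, mem_univ _, hx⟩
    · refine (sum_le_sum fun x _ => prob_path_le hn hr.1 hr.2 x a b m s).trans ?_
      rw [sum_const, nsmul_eq_mul, card_univ, Fintype.card_embedding_eq]
      refine mul_le_mul_of_nonneg_right ?_ (by positivity)
      have := Nat.descFactorial_le_pow n (r + 1)
      simp only [Fintype.card_fin]
      exact_mod_cast this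

/-- Markov's inequality for the number of small vertices. -/
theorem prob_card_smallVertices_le (hn : 10 ≤ n) (a b : ℕ) (s : ℝ) {y : ℝ} (hy : 0 < y) :
    prob {π : PairOrdering n | y ≤ #(smallVertices π a b s)} ≤
      n * (Real.exp 72 * (8 : ℝ) ^ s *
        Real.exp (-(7 / 8 * (n - 1) * (#(window n a b) / (n.choose 2 : ℕ))))) / y := by
  classical
  have h1 : prob {π : PairOrdering n | y ≤ #(smallVertices π a b s)} ≤
      mean fun π => 1 / y * ∑ v : Fin n, if v ∈ smallVertices π a b s then 1 else 0 := by
    refine prob_le_mean (fun π => by positivity) fun π hπ => ?_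
    simp only [sum_boole, filter_mem_eq_inter, univ_inter]
    rw [one_div, ← div_eq_inv_mul, one_le_div hy]
    exact hπ
  refine h1.trans ?_
  rw [mean_const_mul, mean_sum, one_div, div_eq_inv_mul]
  refine mul_le_mul_of_nonneg_left ?_ (by positivity)
  refine (sum_le_sum (g := fun _ => Real.exp 72 * (8 : ℝ) ^ s *
    Real.exp (-(7 / 8 * (n - 1) * (#(window n a b) / (n.choose 2 : ℕ))))) fun v _ => ?_).trans_eq ?_
  · refine le_trans ?_ (prob_star_le hn v a b s)
    rw [prob_eq_mean]
    refine mean_mono fun π => ?_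
    by_cases h : v ∈ smallVertices π a b s
    · rw [if_pos h, if_pos]
      exact (mem_smallVertices.1 h).le
    · rw [if_neg h]; positivity
  · rw [sum_const, card_univ, Fintype.card_fin, nsmul_eq_mul]

open Classical in
theorem degree_graphAt (π : PairOrdering n) (t : ℕ) (v : Fin n) :
    (graphAt π t).degree v = #{e ∈ star v | π e ∈ window n 0 t} := by
  rw [← card_windowGraph_adj, ← card_neighborFinset_eq_degree]
  congr 1
  ext w
  rw [mem_neighborFinset, mem_filter, graphAt_eq]
  simp

theorem mem_minDegreeAtLeast_iff [NeZero n] (π : PairOrdering n) (t k : ℕ) :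
    graphAt π t ∈ GraphGame.minDegreeAtLeast (Fin n) k ↔
      ∀ v, k ≤ #{e ∈ star v | π e ∈ window n 0 t} := by
  classical
  simp only [← degree_graphAt]
  constructor
  · exact fun h v => le_trans h ((graphAt π t).minDegree_le_degree v)
  · exact fun h => (graphAt π t).le_minDegree_of_forall_le_degree _ h

theorem prob_minDegree_lt_two_le (hn : 10 ≤ n) (m : ℕ) :
    prob {π : PairOrdering n | graphAt π m ∉ GraphGame.minDegreeAtLeast (Fin n) 2} ≤
      n * (Real.exp 72 * (8 : ℝ) ^ (1 : ℝ) *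
        Real.exp (-(7 / 8 * (n - 1) * (#(window n 0 m) / (n.choose 2 : ℕ))))) := by
  have : NeZero n := ⟨by omega⟩
  refine (prob_le_sum (univ : Finset (Fin n)) (B := fun v => {π : PairOrdering n |
    (#{e ∈ star v | π e ∈ window n 0 m} : ℝ) ≤ 1}) ?_).trans ?_
  · intro π hπ
    rw [Set.mem_ofPred_eq, mem_minDegreeAtLeast_iff] at hπ
    push Not at hπ
    obtain ⟨v, hv⟩ := hπ
    exact ⟨v, mem_univ v, by
      have : #{e ∈ star v | π e ∈ window n 0 m} ≤ 1 := by omega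
      exact_mod_cast this⟩
  · refine (sum_le_sum fun v _ => prob_star_le hn v 0 m 1).trans_eq ?_
    rw [sum_const, card_univ, Fintype.card_fin, nsmul_eq_mul]

end GraphProcess

/-! ### Isolated vertices, sparsity, and pairs joining large sets -/

namespace GraphProcess

open Finset SimpleGraph

variable {n : ℕ}

theorem prob_eq_mean_of {A : Set (PairOrdering n)} {Φ : PairOrdering n → ℝ}
    (h1 : ∀ π ∈ A, Φ π = 1) (h0 : ∀ π ∉ A, Φ π = 0) : prob A = mean Φ := by
  classical
  rw [prob_eq_mean]
  congr 1
  ext π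
  split_ifs with h
  · exact (h1 π h).symm
  · exact (h0 π h).symm

/-! ### Isolated vertices by the second moment. -/

section Isolated

/-- The probability that `q` given pairs all avoid `N - M` given positions. -/
noncomputable def avoidProb (N M q : ℕ) : ℝ := (M.descFactorial q : ℝ) / N.descFactorial q

theorem prob_mapsTo_eq (Q : Finset (Pair n)) (J : Finset (Fin (n.choose 2))) :
    prob {π : PairOrdering n | ∀ e ∈ Q, π e ∈ J} = avoidProb (n.choose 2) #J #Q := by
  classical
  have h := card_equiv_mapsTo card_pairs_eq Q J
  have hQ : #Q ≤ n.choose 2 := by rw [← card_pairs]; exact card_le_univ Q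
  rw [prob_eq_mean_of (A := {π : PairOrdering n | ∀ e ∈ Q, π e ∈ J})
    (Φ := fun π => if ∀ e ∈ Q, π e ∈ J then 1 else 0)
    (fun π hπ => if_pos hπ) (fun π hπ => if_neg hπ), mean, sum_boole, h, card_pairOrdering, card_pairs, avoidProb, ← Nat.factorial_mul_descFactorial hQ]
  push_cast
  rw [mul_div_mul_left]
  exact_mod_cast (Nat.factorial_pos _).ne'

theorem avoidProb_succ (N M q : ℕ) :
    avoidProb N M (q + 1) = avoidProb N M q * (((M - q : ℕ) : ℝ) / ((N - q : ℕ) : ℝ)) := by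
  simp only [avoidProb, Nat.descFactorial_succ]
  push_cast
  rw [mul_div_mul_comm, mul_comm]

theorem avoidProb_nonneg (N M q : ℕ) : 0 ≤ avoidProb N M q := by
  rw [avoidProb]; positivity

theorem sub_div_sub_anti {N M i j : ℕ} (hM : M ≤ N) (hij : i ≤ j) (hj : j < N) :
    ((M - j : ℕ) : ℝ) / ((N - j : ℕ) : ℝ) ≤ ((M - i : ℕ) : ℝ) / ((N - i : ℕ) : ℝ) := by
  rw [div_le_div_iff₀ (by exact_mod_cast (by omega)) (by exact_mod_cast (by omega))]
  norm_cast
  rcases Nat.lt_or_ge M j with h | h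
  · rw [Nat.sub_eq_zero_of_le h.le]; simp
  · obtain ⟨a, rfl⟩ := Nat.exists_eq_add_of_le h
    obtain ⟨b, rfl⟩ := Nat.exists_eq_add_of_le hM
    obtain ⟨c, rfl⟩ := Nat.exists_eq_add_of_le hij
    have e1 : i + c + a - (i + c) = a := by omega
    have e2 : i + c + a + b - i = c + a + b := by omega
    have e3 : i + c + a - i = c + a := by omega
    have e4 : i + c + a + b - (i + c) = a + b := by omega
    rw [e1, e2, e3, e4]
    nlinarith [Nat.zero_le (c * b)]

/-- Sampling without replacement is negatively correlated: the successive factors `(M - q) / (N -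
q)` decrease in `q`. -/
theorem avoidProb_add_le {N M : ℕ} (hM : M ≤ N) (a : ℕ) :
    ∀ i, a + i ≤ N → avoidProb N M (a + i) ≤ avoidProb N M a * avoidProb N M i
  | 0, _ => by simp [avoidProb]
  | i + 1, h => by
    rw [← add_assoc, avoidProb_succ, avoidProb_succ, ← mul_assoc]
    refine mul_le_mul (avoidProb_add_le hM a i (by omega))
      (sub_div_sub_anti hM (by omega) (by omega)) (by positivity)
      (mul_nonneg (avoidProb_nonneg _ _ _) (avoidProb_nonneg _ _ _))

theorem pow_le_avoidProb {N M a : ℕ} (hM : M ≤ N) (ha : a < N) :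
    ∀ i ≤ a, (((M - a : ℕ) : ℝ) / ((N - a : ℕ) : ℝ)) ^ i ≤ avoidProb N M i
  | 0, _ => by simp [avoidProb]
  | i + 1, h => by
    rw [pow_succ, avoidProb_succ]
    exact mul_le_mul (pow_le_avoidProb hM ha i (by omega))
      (sub_div_sub_anti hM (by omega) ha) (by positivity) (avoidProb_nonneg _ _ _)

/-- With few pairs there is an isolated vertex, by the second moment method. -/
theorem prob_minDegree_ge_two_le (hn : 10 ≤ n) {m : ℕ} (hm : n + m < n.choose 2) :
    prob {π : PairOrdering n | graphAt π m ∈ GraphGame.minDegreeAtLeast (Fin n) 2} ≤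
      Real.exp (n * (m / ((n.choose 2 : ℕ) - n - m))) / n + m / ((n.choose 2 : ℕ) - n - m) := by
  classical
  have : NeZero n := ⟨by omega⟩
  set N := n.choose 2 with hN
  have hn0 : (0 : ℝ) < n := by positivity
  have hD : (0 : ℝ) < (N : ℝ) - n - m := by
    have : ((n + m : ℕ) : ℝ) < N := by exact_mod_cast hm
    push_cast at this; linarith
  set η : ℝ := m / ((N : ℝ) - n - m) with hη
  have hη0 : 0 ≤ η := by positivity
  have hJ : #(window n m N) = N - m := card_window le_rfl
  set ρ := avoidProb N (N - m) with hρ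
  set X : Fin n → PairOrdering n → ℝ := fun v π =>
    if ∀ e ∈ star v, π e ∈ window n m N then 1 else 0 with hX
  have hX1 : ∀ v, mean (X v) = ρ (n - 1) := fun v => by
    rw [hρ, ← hJ, ← card_star v, ← prob_mapsTo_eq]
    exact (prob_eq_mean_of (fun π hπ => if_pos hπ) (fun π hπ => if_neg hπ)).symm
  have hXX : ∀ u v, u ≠ v → mean (fun π => X u π * X v π) = ρ (2 * n - 3) := fun u v huv => by
    rw [hρ, ← hJ, ← card_star_union_star huv, ← prob_mapsTo_eq]
    refine (prob_eq_mean_of (fun π hπ => ?_) (fun π hπ => ?_)).symm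
    · simp only [hX]
      rw [if_pos fun e he => hπ e (mem_union_left _ he),
        if_pos fun e he => hπ e (mem_union_right _ he), mul_one]
    · simp only [hX]
      by_contra hne
      obtain ⟨hu, hv⟩ := mul_ne_zero_iff.1 hne
      exact hπ fun e he => (mem_union.1 he).elim (of_not_not (fun h => hu (if_neg h)) e)
        (of_not_not (fun h => hv (if_neg h)) e)
  have hXs : ∀ v π, X v π * X v π = X v π := fun v π => by simp only [hX]; split_ifs <;> simp
  -- A lower bound is needed here, which domination by independent positions cannot give; hence the
  -- exact formula `avoidProb`.
  have hρpos : Real.exp (-(n * η)) ≤ ρ (n - 1) := by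
    have h1 := pow_le_avoidProb (N := N) (M := N - m) (a := n) (Nat.sub_le _ _) (by omega) (n - 1)
      (by omega)
    refine le_trans ?_ h1
    have e1 : ((N - m - n : ℕ) : ℝ) = (N : ℝ) - n - m := by
      rw [Nat.cast_sub (by omega), Nat.cast_sub (by omega)]; ring
    have e2 : ((N - n : ℕ) : ℝ) = (N : ℝ) - n := by rw [Nat.cast_sub (by omega)]
    rw [e1, e2]
    have hDm : (0 : ℝ) < (N : ℝ) - n := by
      have : (0 : ℝ) ≤ m := by positivity
      linarith
    have h2 : Real.exp (-η) ≤ ((N : ℝ) - n - m) / (N - n) := by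
      rw [Real.exp_neg, inv_le_comm₀ (Real.exp_pos _) (by positivity), inv_div]
      refine le_trans (le_of_eq ?_) (Real.add_one_le_exp η)
      rw [hη]; field_simp; ring
    have h3 : ((N : ℝ) - n - m) / (N - n) ≤ 1 := by
      apply div_le_one_of_le₀ _ hDm.le
      have : (0 : ℝ) ≤ m := by positivity
      linarith
    calc Real.exp (-(n * η)) = Real.exp (-η) ^ n := by
          rw [← Real.exp_nat_mul]; congr 1; ring
      _ ≤ (((N : ℝ) - n - m) / (N - n)) ^ n := by gcongr
      _ ≤ _ := pow_le_pow_of_le_one (by positivity) h3 (by omega)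
  have hρ0 : 0 < ρ (n - 1) := (Real.exp_pos _).trans_le hρpos
  -- Two stars share one pair, so the joint event involves `(n - 1) + (n - 2)` pairs; the missing
  -- factor of `ρ (n - 1)` costs at most `1 + η`.
  have hρ2 : ρ (2 * n - 3) ≤ ρ (n - 1) * (ρ (n - 1) * (1 + η)) := by
    have h1 := avoidProb_add_le (N := N) (M := N - m) (Nat.sub_le _ _) (n - 1) (n - 2) (by
      have := (choose_two_bounds hn).1
      rw [← hN] at this
      have h10 : (10 : ℝ) ≤ n := by exact_mod_cast hn
      have : 2 * (n : ℝ) ≤ N := by nlinarith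
      have : 2 * n ≤ N := by exact_mod_cast this
      omega)
    rw [show n - 1 + (n - 2) = 2 * n - 3 by omega] at h1
    refine h1.trans ?_
    refine mul_le_mul_of_nonneg_left ?_ hρ0.le
    have h2 := avoidProb_succ N (N - m) (n - 2)
    rw [show n - 2 + 1 = n - 1 by omega] at h2
    have e1 : ((N - m - (n - 2) : ℕ) : ℝ) = (N : ℝ) - n - m + 2 := by
      rw [Nat.cast_sub (by omega), Nat.cast_sub (by omega), Nat.cast_sub (by omega)]
      push_cast; ring
    have e2 : ((N - (n - 2) : ℕ) : ℝ) = (N : ℝ) - n + 2 := by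
      rw [Nat.cast_sub (by omega), Nat.cast_sub (by omega)]; push_cast; ring
    rw [e1, e2] at h2
    change avoidProb N (N - m) (n - 2) ≤ avoidProb N (N - m) (n - 1) * (1 + η)
    rw [h2, mul_assoc]
    refine le_mul_of_one_le_right (avoidProb_nonneg _ _ _) ?_
    have hm0 : (0 : ℝ) ≤ m := by positivity
    have hη1 : η * ((N : ℝ) - n - m) = m := by rw [hη]; field_simp
    rw [div_mul_eq_mul_div, one_le_div (by linarith)]
    nlinarith
  set μ : ℝ := n * ρ (n - 1) with hμ
  have hμ0 : 0 < μ := by positivity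
  have hS2 : mean (fun π => (∑ v, X v π) * ∑ v, X v π) ≤ μ + μ ^ 2 * (1 + η) := by
    have h1 : ∀ π, (∑ v, X v π) * ∑ v, X v π = ∑ u, ∑ v, X u π * X v π := fun π => by
      rw [sum_mul_sum]
    simp only [h1]
    rw [mean_sum]
    have h2 : ∀ u, mean (fun π => ∑ v, X u π * X v π) ≤
        ρ (n - 1) + n * (ρ (n - 1) * (ρ (n - 1) * (1 + η))) := fun u => by
      rw [mean_sum, ← add_sum_erase univ _ (mem_univ u)]
      simp only [hXs, hX1]
      gcongr
      refine (sum_le_sum (g := fun _ => ρ (n - 1) * (ρ (n - 1) * (1 + η))) fun v hv => ?_).trans ?_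
      · rw [hXX u v (ne_of_mem_erase hv).symm]
        exact hρ2
      · rw [sum_const, nsmul_eq_mul]
        gcongr
        have := card_le_univ (univ.erase u)
        rwa [Fintype.card_fin] at this
    refine (sum_le_sum fun u _ => h2 u).trans (le_of_eq ?_)
    rw [sum_const, card_univ, Fintype.card_fin, nsmul_eq_mul, hμ]
    ring
  have hS1 : mean (fun π => ∑ v, X v π) = μ := by
    rw [mean_sum]
    simp only [hX1, sum_const, card_univ, Fintype.card_fin, nsmul_eq_mul, hμ]
  -- Chebyshev: minimum degree 2 forces the number of isolated vertices to be 0, at distance `μ`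
  -- from its mean, while the variance is at most `μ + η * μ ^ 2`.
  have hkey : prob {π : PairOrdering n | graphAt π m ∈ GraphGame.minDegreeAtLeast (Fin n) 2} ≤
      mean (fun π => (1 / μ ^ 2) * ((∑ v, X v π) * (∑ v, X v π) +
        ((-2 * μ) * (∑ v, X v π) + μ ^ 2))) := by
    have hsq : ∀ π, (∑ v, X v π) * (∑ v, X v π) + ((-2 * μ) * (∑ v, X v π) + μ ^ 2) =
        ((∑ v, X v π) - μ) ^ 2 := fun π => by ring
    simp only [hsq]
    refine prob_le_mean (fun π => by positivity) fun π hπ => ?_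
    have h0 : ∀ v, X v π = 0 := fun v => by
      have := (mem_minDegreeAtLeast_iff π m 2).1 hπ v
      simp only [hX]
      rw [if_neg]
      intro hall
      obtain ⟨e, he⟩ := card_pos.1 (lt_of_lt_of_le (by norm_num) this)
      rw [mem_filter, mem_window] at he
      have := mem_window.1 (hall e he.1)
      omega
    simp only [h0, sum_const_zero, zero_sub, even_two, Even.neg_pow]
    rw [one_div, inv_mul_cancel₀ (by positivity)]
  refine hkey.trans ?_
  rw [mean_const_mul, mean_add, mean_add, mean_const_mul, hS1, mean_const]
  calc 1 / μ ^ 2 * (mean (fun π => (∑ v, X v π) * ∑ v, X v π) + (-2 * μ * μ + μ ^ 2))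
      ≤ 1 / μ ^ 2 * ((μ + μ ^ 2 * (1 + η)) + (-2 * μ * μ + μ ^ 2)) := by gcongr
    _ = 1 / μ + η := by field_simp; ring
    _ ≤ _ := by
      gcongr ?_ + η
      rw [hμ, div_le_div_iff₀ hμ0 hn0]
      have : 1 ≤ Real.exp (n * η) * ρ (n - 1) := by
        calc (1 : ℝ) = Real.exp (n * η) * Real.exp (-(n * η)) := by rw [← Real.exp_add]; simp
          _ ≤ _ := by gcongr
      nlinarith

end Isolated

/-! ### Local sparsity. -/

section Sparse

/-- Union bound over the sets of `r` pairs inside `U`; the crude count `#U ^ 2` of pairs is enough.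
-/
theorem prob_le_card_edgesWithin_le (U : Finset (Fin n)) (m : ℕ) {r : ℕ} (hr : r < n.choose 2) :
    prob {π : PairOrdering n | r ≤ #((graphAt π m).edgesWithin U)} ≤
      ((#U ^ 2).choose r : ℝ) * ((#(window n 0 m) : ℝ) / ((n.choose 2 : ℕ) - r : ℝ)) ^ r := by
  classical
  set P : Finset (Pair n) := {e | ∀ v ∈ e.1, v ∈ U} with hP
  have hPc : #P ≤ #U ^ 2 := by
    calc #P ≤ #((U ×ˢ U).image fun p => s(p.1, p.2)) := by
          refine card_le_card_of_injOn (fun e => e.1) ?_ (Subtype.val_injective.injOn)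
          rintro ⟨e, he⟩ heP
          induction e using Sym2.ind with
          | _ a b =>
            have := (mem_filter.1 heP).2
            simp only [coe_image, Set.mem_image, mem_coe, mem_product]
            exact ⟨(a, b), ⟨this a (Sym2.mem_mk_left _ _), this b (Sym2.mem_mk_right _ _)⟩, rfl⟩
      _ ≤ #(U ×ˢ U) := card_image_le
      _ = #U ^ 2 := by rw [card_product, sq]
  refine (prob_le_sum (powersetCard r P)
    (B := fun F => {π : PairOrdering n | ∀ e ∈ F, π e ∈ window n 0 m}) ?_).trans ?_
  · intro π hπ
    have h1 : #((graphAt π m).edgesWithin U) ≤ #{e ∈ P | π e ∈ window n 0 m} := by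
      refine card_le_card_of_surjOn (fun e => e.1) fun e he => ?_
      rw [mem_coe, mem_edgesWithin, graphAt_eq, mem_edgeSet_windowGraph] at he
      obtain ⟨⟨hd, hw⟩, hU⟩ := he
      exact ⟨⟨e, hd⟩, by simpa [hP] using ⟨hU, hw⟩, rfl⟩
    obtain ⟨F, hF, hFc⟩ := exists_subset_card_eq (hπ.trans h1)
    refine ⟨F, mem_powersetCard.2 ⟨hF.trans (filter_subset _ _), hFc⟩, fun e he => ?_⟩
    exact (mem_filter.1 (hF he)).2
  · have h2 : ∀ F ∈ powersetCard r P, prob {π : PairOrdering n | ∀ e ∈ F, π e ∈ window n 0 m} ≤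
        ((#(window n 0 m) : ℝ) / ((n.choose 2 : ℕ) - r : ℝ)) ^ r := fun F hF => by
      have hFc := (mem_powersetCard.1 hF).2
      have := prob_mapsTo_le F (by rw [hFc]; exact hr) (window n 0 m)
      rwa [hFc] at this
    refine (sum_le_sum h2).trans ?_
    rw [sum_const, card_powersetCard, nsmul_eq_mul]
    have : (0 : ℝ) < (n.choose 2 : ℕ) - r := by rw [sub_pos]; exact_mod_cast hr
    refine mul_le_mul_of_nonneg_right ?_ (by positivity)
    exact_mod_cast Nat.choose_le_choose r hPc

theorem choose_mul_pow_le (M r : ℕ) (hr : 0 < r) {p : ℝ} (hp : 0 ≤ p) :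
    (M.choose r : ℝ) * p ^ r ≤ (Real.exp 1 * M * p / r) ^ r := by
  have hr' : (0 : ℝ) < r := by exact_mod_cast hr
  have h1 : (M.choose r : ℝ) ≤ (M : ℝ) ^ r / r.factorial := Nat.choose_le_pow_div r M
  have h2 := Real.pow_div_factorial_le_exp (r : ℝ) hr'.le r
  have h3 : (1 : ℝ) / r.factorial ≤ Real.exp 1 ^ r / (r : ℝ) ^ r := by
    rw [le_div_iff₀ (by positivity), ← Real.exp_nat_mul, mul_one]
    calc _ = (r : ℝ) ^ r / r.factorial := by ring
      _ ≤ _ := h2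
  calc (M.choose r : ℝ) * p ^ r ≤ ((M : ℝ) ^ r / r.factorial) * p ^ r := by gcongr
    _ = (M : ℝ) ^ r * p ^ r * (1 / r.factorial) := by ring
    _ ≤ (M : ℝ) ^ r * p ^ r * (Real.exp 1 ^ r / (r : ℝ) ^ r) := by gcongr
    _ = _ := by rw [div_pow, mul_pow, mul_pow]; ring

/-- The binomial theorem for `(exp (-c) + 1) ^ n`; removing the empty set makes the bound tend to 0
when `n * exp (-c)` does. -/
theorem sum_exp_card_le (n : ℕ) (c : ℝ) :
    ∑ U ∈ (univ : Finset (Finset (Fin n))).erase ∅, Real.exp (-(c * #U)) ≤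
      Real.exp (n * Real.exp (-c)) - 1 := by
  classical
  have h := Finset.sum_pow_mul_eq_add_pow (Real.exp (-c)) 1 (univ : Finset (Fin n))
  simp only [one_pow, mul_one, powerset_univ, card_univ, Fintype.card_fin] at h
  have h1 : ∀ U : Finset (Fin n), Real.exp (-c) ^ #U = Real.exp (-(c * #U)) := fun U => by
    rw [← Real.exp_nat_mul]; congr 1; ring
  simp only [h1] at h
  rw [← add_sum_erase univ _ (mem_univ ∅)] at h
  simp only [card_empty, Nat.cast_zero, mul_zero, neg_zero, Real.exp_zero] at h
  have h2 : (Real.exp (-c) + 1) ^ n ≤ Real.exp (n * Real.exp (-c)) := by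
    rw [Real.exp_nat_mul]
    exact pow_le_pow_left₀ (by positivity) (Real.add_one_le_exp _) n
  linarith

end Sparse

/-! ### Consecutive pairs of early edges joining large sets. -/

section Pairs

/-- The positions `2 * i` and `2 * i + 1`. -/
def pairPositions (n k : ℕ) (hk : 2 * k ≤ n.choose 2) : Fin k × Bool ↪ Fin (n.choose 2) where
  toFun x := ⟨2 * x.1 + x.2.toNat, by have := x.1.2; have := Bool.toNat_lt x.2; omega⟩
  inj' := by
    rintro ⟨⟨i, hi⟩, c⟩ ⟨⟨j, hj⟩, c'⟩ h
    simp only [Fin.mk.injEq] at h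
    have h1 := Bool.toNat_lt c
    have h2 := Bool.toNat_lt c'
    have : i = j := by omega
    subst this
    have : c.toNat = c'.toNat := by omega
    cases c <;> cases c' <;> simp_all

theorem card_no_pair_within {β : Type*} [Fintype β] [DecidableEq β] (k : ℕ) (T : Finset β) :
    #{f : Fin k × Bool → β | ∀ i, ∃ c, f (i, c) ∉ T} = (Fintype.card β ^ 2 - #T ^ 2) ^ k := by
  have h1 : #{g : Bool → β | ∃ c, g c ∉ T} = Fintype.card β ^ 2 - #T ^ 2 := by
    have h2 : ({g : Bool → β | ∃ c, g c ∉ T} : Finset (Bool → β)) =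
        (Fintype.piFinset fun _ : Bool => T)ᶜ := by
      ext g
      simp only [mem_filter, mem_univ, true_and, mem_compl, Fintype.mem_piFinset, not_forall]
    rw [h2, card_compl, Fintype.card_piFinset]
    simp [sq]
  rw [← h1]
  have h3 := Fintype.card_piFinset fun _ : Fin k => ({g : Bool → β | ∃ c, g c ∉ T} : Finset _)
  rw [prod_const, card_univ, Fintype.card_fin] at h3
  rw [← h3]
  refine card_equiv (Equiv.curry _ _ _) fun f => ?_
  simp [Fintype.mem_piFinset]

/-- Read from positions to edges, the first `2k` edges are dominated by independent uniform ones,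
for which each of the `k` blocks lies in `T` with probability `(#T / N) ^ 2`. The first exponential
is the cost of the domination. -/
theorem prob_no_pair_within_le {k : ℕ} (hk : 2 * k < n.choose 2) (T : Finset (Pair n)) :
    prob {π : PairOrdering n | ∀ i, ∃ c, π.symm (pairPositions n k hk.le (i, c)) ∉ T} ≤
      Real.exp ((2 * k) ^ 2 / ((n.choose 2 : ℕ) - 2 * k)) *
        Real.exp (-(k * (#T / (n.choose 2 : ℕ)) ^ 2)) := by
  classical
  set N : ℝ := ((n.choose 2 : ℕ) : ℝ) with hN
  have hkN : 2 * (k : ℝ) < N := by rw [hN]; exact_mod_cast hk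
  have hk0 : (0 : ℝ) ≤ k := by positivity
  have hN0 : (0 : ℝ) < N := by linarith
  have hd : (0 : ℝ) < (N : ℝ) - 2 * k := by linarith
  have hT : #T ≤ n.choose 2 := by rw [← card_pairs]; exact card_le_univ T
  have hTr : (#T : ℝ) ≤ N := by rw [hN]; exact_mod_cast hT
  have h1 := sum_comp_embedding_le card_pairs_eq.symm (pairPositions n k hk.le)
    (Φ := fun f => if ∀ i, ∃ c, f (i, c) ∉ T then (1 : ℝ) else 0) (fun f => by positivity)
  have h0 : ∑ f : Fin k × Bool → Pair n, (if ∀ i, ∃ c, f (i, c) ∉ T then (1 : ℝ) else 0) =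
      ((Fintype.card (Pair n) ^ 2 - #T ^ 2) ^ k : ℕ) := by
    rw [sum_boole, card_no_pair_within]
  rw [h0] at h1
  have h2 : ∑ π : Fin (n.choose 2) ≃ Pair n,
      (if ∀ i, ∃ c, π (pairPositions n k hk.le (i, c)) ∉ T then (1 : ℝ) else 0) =
      ∑ π : PairOrdering n,
        if ∀ i, ∃ c, π.symm (pairPositions n k hk.le (i, c)) ∉ T then (1 : ℝ) else 0 := by
    refine (Fintype.sum_bijective Equiv.symm Equiv.symm_bijective _ _ fun π => rfl).symm
  rw [h2] at h1
  have hq : Fintype.card (Fin k × Bool) = 2 * k := by simp [mul_comm]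
  rw [hq, Fintype.card_fin, card_pairs] at h1
  rw [prob_eq_mean_of (A := {π : PairOrdering n | ∀ i, ∃ c,
      π.symm (pairPositions n k hk.le (i, c)) ∉ T})
    (Φ := fun π => if ∀ i, ∃ c,
    π.symm (pairPositions n k hk.le (i, c)) ∉ T then 1 else 0) (fun π hπ => if_pos hπ)
    (fun π hπ => if_neg hπ), mean, card_pairOrdering]
  have h3 := factorial_ratio_le hk
  rw [div_le_iff₀ (by exact_mod_cast Nat.factorial_pos _)] at h3 ⊢
  refine h1.trans ?_
  push_cast at h3
  rw [← hN] at h3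
  have hsq : #T ^ 2 ≤ n.choose 2 ^ 2 := Nat.pow_le_pow_left hT 2
  have h4 : ((n.choose 2 ^ 2 - #T ^ 2 : ℕ) : ℝ) = N ^ 2 * (1 - (#T / N) ^ 2) := by
    rw [Nat.cast_sub hsq]; push_cast; rw [← hN]; field_simp
  have hTN : ((#T : ℝ) / N) ^ 2 ≤ 1 := pow_le_one₀ (by positivity) (div_le_one_of_le₀ hTr hN0.le)
  have h5 : ((N : ℝ) / (N - 2 * k)) ^ (2 * k) ≤ Real.exp ((2 * k) ^ 2 / (N - 2 * k)) := by
    have e1 : (N : ℝ) / (N - 2 * k) ≤ Real.exp (2 * k / (N - 2 * k)) := by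
      refine le_trans (le_of_eq ?_) (Real.add_one_le_exp _)
      field_simp; ring
    calc _ ≤ Real.exp (2 * k / (N - 2 * k)) ^ (2 * k) := by gcongr
      _ = _ := by rw [← Real.exp_nat_mul]; congr 1; push_cast; ring
  have h6 : (1 - ((#T : ℝ) / N) ^ 2) ^ k ≤ Real.exp (-(k * (#T / N) ^ 2)) := by
    have e1 := Real.add_one_le_exp (-((#T : ℝ) / N) ^ 2)
    calc _ ≤ Real.exp (-((#T : ℝ) / N) ^ 2) ^ k := by
          gcongr
          · linarith
      _ = _ := by rw [← Real.exp_nat_mul]; congr 1; ring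
  push_cast
  rw [h4]
  have h7 : 0 ≤ 1 - ((#T : ℝ) / N) ^ 2 := by linarith
  calc ((n.choose 2 - 2 * k).factorial : ℝ) * ((N : ℝ) ^ 2 * (1 - (#T / N) ^ 2)) ^ k
      ≤ (1 / ((N : ℝ) - 2 * k) ^ (2 * k) * (n.choose 2).factorial) *
        ((N : ℝ) ^ 2 * (1 - (#T / N) ^ 2)) ^ k := by gcongr
    _ = (((N : ℝ) / (N - 2 * k)) ^ (2 * k) * (1 - (#T / N) ^ 2) ^ k) * (n.choose 2).factorial := by
      rw [div_pow, mul_pow, ← pow_mul]; ring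
    _ ≤ _ := by gcongr

/-- The pairs with one element in `A` and one in `B`. -/
noncomputable def crossPairs (A B : Finset (Fin n)) : Finset (Pair n) :=
  open Classical in {e | ∃ a ∈ A, ∃ b ∈ B, e.1 = s(a, b)}

theorem mem_crossPairs {A B : Finset (Fin n)} {e : Pair n} :
    e ∈ crossPairs A B ↔ ∃ a ∈ A, ∃ b ∈ B, e.1 = s(a, b) := by simp [crossPairs]

theorem le_card_crossPairs {A B : Finset (Fin n)} (h : Disjoint A B) :
    #A * #B ≤ #(crossPairs A B) := by
  classical
  have hinj : Set.InjOn (fun p : Fin n × Fin n => s(p.1, p.2)) (A ×ˢ B : Finset _) := by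
    rintro ⟨a, b⟩ hab ⟨c, d⟩ hcd heq
    rw [mem_coe, mem_product] at hab hcd
    rcases Sym2.eq_iff.1 heq with ⟨h1, h2⟩ | ⟨h1, h2⟩
    · exact Prod.ext h1 h2
    · exact absurd (h1 ▸ hab.1) fun hd => Finset.disjoint_left.1 h hd hcd.2
  rw [← card_product, ← card_image_of_injOn hinj]
  refine (card_le_card fun e he => ?_).trans (card_image_le (s := crossPairs A B) (f := Subtype.val))
  obtain ⟨⟨a, b⟩, hab, rfl⟩ := mem_image.1 he
  rw [mem_product] at hab
  have hne : a ≠ b := fun h' => Finset.disjoint_left.1 h hab.1 (h' ▸ hab.2)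
  exact mem_image.2 ⟨mkPair a b hne, mem_crossPairs.2 ⟨a, hab.1, b, hab.2, rfl⟩, rfl⟩

/-- Union bound over at most `4 ^ n` choices of `A` and `B`, with at least `y ^ 2` cross pairs each.
It succeeds because `k` will be a large multiple of `n`. -/
theorem prob_no_pair_joining_le {k : ℕ} (hk : 2 * k < n.choose 2) {y : ℝ} (hy : 0 ≤ y) :
    prob {π : PairOrdering n | ∃ A B : Finset (Fin n), Disjoint A B ∧ y ≤ #A ∧ y ≤ #B ∧
      ∀ i, ∃ c, π.symm (pairPositions n k hk.le (i, c)) ∉ crossPairs A B} ≤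
      4 ^ n * (Real.exp ((2 * k) ^ 2 / ((n.choose 2 : ℕ) - 2 * k)) *
        Real.exp (-(k * (y ^ 2 / (n.choose 2 : ℕ)) ^ 2))) := by
  classical
  refine (prob_le_sum ((univ : Finset (Finset (Fin n) × Finset (Fin n))).filter
      fun X => Disjoint X.1 X.2 ∧ y ≤ #X.1 ∧ y ≤ #X.2)
    (B := fun X => {π : PairOrdering n | ∀ i, ∃ c,
      π.symm (pairPositions n k hk.le (i, c)) ∉ crossPairs X.1 X.2}) ?_).trans ?_
  · rintro π ⟨A, B, h1, h2, h3, h4⟩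
    exact ⟨(A, B), by simp [h1, h2, h3], h4⟩
  · refine (sum_le_card_nsmul _ _ (Real.exp ((2 * k) ^ 2 / ((n.choose 2 : ℕ) - 2 * k)) *
        Real.exp (-(k * (y ^ 2 / (n.choose 2 : ℕ)) ^ 2))) ?_).trans ?_
    · rintro ⟨A, B⟩ hX
      obtain ⟨h1, h2, h3⟩ := (mem_filter.1 hX).2
      refine (prob_no_pair_within_le hk _).trans ?_
      have h4 : y ^ 2 ≤ #(crossPairs A B) := by
        have h5 : ((#A * #B : ℕ) : ℝ) ≤ #(crossPairs A B) := by
          exact_mod_cast le_card_crossPairs h1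
        push_cast at h5
        simp only at h2 h3
        nlinarith
      gcongr
    · rw [nsmul_eq_mul]
      refine mul_le_mul_of_nonneg_right ?_ (by positivity)
      have h5 := card_filter_le (univ : Finset (Finset (Fin n) × Finset (Fin n)))
        (fun X => Disjoint X.1 X.2 ∧ y ≤ #X.1 ∧ y ≤ #X.2)
      rw [card_univ, Fintype.card_prod, Fintype.card_finset, Fintype.card_fin, ← mul_pow] at h5
      exact_mod_cast h5

end Pairs

end GraphProcess

/-! ### Equality of the hitting times -/

namespace GraphProcess

open Finset SimpleGraph

variable {n : ℕ}

theorem minDegreeAtLeast_mono [NeZero n] {π : PairOrdering n} {s t k : ℕ} (hst : s ≤ t)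
    (h : graphAt π s ∈ GraphGame.minDegreeAtLeast (Fin n) k) :
    graphAt π t ∈ GraphGame.minDegreeAtLeast (Fin n) k := by
  rw [mem_minDegreeAtLeast_iff] at h ⊢
  refine fun v => (h v).trans (card_le_card fun e he => ?_)
  simp only [mem_filter, mem_window] at he ⊢
  exact ⟨he.1, he.2.1, he.2.2.trans_le hst⟩

theorem hittingTime_eq_of_subset {π : PairOrdering n} {P Q : Set (SimpleGraph (Fin n))}
    (hPQ : P ⊆ Q) {t : ℕ} (ht : t ≤ n.choose 2) (htP : graphAt π t ∈ P)
    (hmin : ∀ s < t, graphAt π s ∉ Q) : hittingTime π P = hittingTime π Q := by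
  apply le_antisymm
  · refine le_trans (sInf_le ⟨t, ht, htP, rfl⟩) (le_sInf ?_)
    rintro _ ⟨s, -, hs, rfl⟩
    by_contra! hlt
    exact hmin s (by exact_mod_cast hlt) hs
  · exact sInf_le_sInf fun τ ⟨s, hs, hsP, h⟩ => ⟨s, hs, hPQ hsP, h⟩

/-- Deterministic conditions for the equality of the two hitting times. -/
theorem hittingTime_makersWin_eq (hn : Even n) [NeZero n] {π : PairOrdering n} {k m₀ m₁ d : ℕ}
    {s x : ℝ} (hk : 2 * k ≤ n.choose 2) (hkm : 2 * k ≤ m₀) (hm₁ : m₁ ≤ n.choose 2)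
    (hd : 0 < d) (hds : (4 * d + 3 : ℝ) ≤ s) (h6 : 6 * x ≤ n)
    (hA : graphAt π m₀ ∉ GraphGame.minDegreeAtLeast (Fin n) 2)
    (hB : graphAt π m₁ ∈ GraphGame.minDegreeAtLeast (Fin n) 2)
    (hC : GraphGame.FarApart (graphAt π m₁) (smallVertices π (2 * k) m₀ s))
    (hD : (#(smallVertices π (2 * k) m₀ s) : ℝ) < x / 2)
    (hE : ∀ U : Finset (Fin n), (#U : ℝ) < 3 * x →
      3 * #((graphAt π m₁).edgesWithin U) ≤ d * #U)
    (hF : ∀ A B : Finset (Fin n), Disjoint A B → x / 2 ≤ #A → x / 2 ≤ #B →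
      ∃ i, ∀ c, π.symm (pairPositions n k hk (i, c)) ∈ crossPairs A B) :
    hittingTime π (GraphGame.makersWin (GraphGame.perfMatch (Fin n))) =
      hittingTime π (GraphGame.minDegreeAtLeast (Fin n) 2) := by
  classical
  have hV : Even (Fintype.card (Fin n)) := by rwa [Fintype.card_fin]
  have hex : ∃ t, graphAt π t ∈ GraphGame.minDegreeAtLeast (Fin n) 2 := ⟨m₁, hB⟩
  set t := Nat.find hex with ht
  have htmem : graphAt π t ∈ GraphGame.minDegreeAtLeast (Fin n) 2 := Nat.find_spec hex
  have htm₁ : t ≤ m₁ := Nat.find_min' hex hB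
  have hm₀t : m₀ ≤ t := by
    by_contra! h
    exact hA (minDegreeAtLeast_mono h.le htmem)
  refine hittingTime_eq_of_subset (fun G hG => GraphGame.two_le_degree_of_makersWin hV hG)
    (htm₁.trans hm₁) ?_ (fun s hs => Nat.find_min hex hs)
  have hpos : ∀ y, (pairPositions n k hk y : ℕ) < 2 * k := fun y => by
    have := y.1.2
    have := Bool.toNat_lt y.2
    have : (pairPositions n k hk y : ℕ) = 2 * y.1 + y.2.toNat := rfl
    omega
  have happ : ∀ y, π (π.symm (pairPositions n k hk y)) = pairPositions n k hk y := fun y =>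
    π.apply_symm_apply _
  -- `W ≤ G_t ≤ H` with `W` and `H` independent of the hitting time `t`. Starting `W` at position `2
  -- * k` keeps it disjoint from the paired early edges.
  refine GraphGame.mem_makersWin_perfMatch hV (H := graphAt π m₁) (W := windowGraph π (2 * k) m₀)
    (S := smallVertices π (2 * k) m₀ s) (d := d) (x := x) (κ := Fin k) ?_ ?_ hd
    (by rwa [Fintype.card_fin]) (by linarith) htmem hC ?_ hE
    (fun y => (π.symm (pairPositions n k hk y)).1) ?_ ?_ ?_ ?_
  · rw [graphAt_eq, graphAt_eq]
    exact windowGraph_mono π le_rfl htm₁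
  · rw [graphAt_eq]
    exact windowGraph_mono π (Nat.zero_le _) hm₀t
  · intro v hv
    rw [mem_smallVertices, not_lt] at hv
    rw [card_windowGraph_adj]
    exact_mod_cast hds.trans hv
  · exact Subtype.val_injective.comp (π.symm.injective.comp (pairPositions n k hk).injective)
  · intro y
    rw [graphAt_eq, mem_edgeSet_windowGraph]
    refine ⟨(π.symm (pairPositions n k hk y)).2, ?_⟩
    rw [Subtype.coe_eta, happ, mem_window]
    have := hpos y
    omega
  · intro y hy
    rw [mem_edgeSet_windowGraph] at hy
    obtain ⟨_, hy⟩ := hy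
    rw [Subtype.coe_eta, happ, mem_window] at hy
    have := hpos y
    omega
  · intro A B hAB hxA hxB
    obtain ⟨i, hi⟩ := hF A B hAB (by linarith) (by linarith)
    exact ⟨i, fun c => mem_crossPairs.1 (hi c)⟩

/-- The failure probability, as a sum over the failure of the deterministic conditions. -/
theorem one_sub_le_prob_hittingTime_eq (hn : Even n) [NeZero n] {k m₀ m₁ d : ℕ}
    {s x : ℝ} (hk : 2 * k ≤ n.choose 2) (hkm : 2 * k ≤ m₀) (hm₁ : m₁ ≤ n.choose 2)
    (hd : 0 < d) (hds : (4 * d + 3 : ℝ) ≤ s) (h6 : 6 * x ≤ n) :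
    1 - (prob {π : PairOrdering n | graphAt π m₀ ∈ GraphGame.minDegreeAtLeast (Fin n) 2} +
      prob {π : PairOrdering n | graphAt π m₁ ∉ GraphGame.minDegreeAtLeast (Fin n) 2} +
      prob {π : PairOrdering n | ¬ GraphGame.FarApart (graphAt π m₁)
        (smallVertices π (2 * k) m₀ s)} +
      prob {π : PairOrdering n | x / 2 ≤ #(smallVertices π (2 * k) m₀ s)} +
      prob {π : PairOrdering n | ∃ U : Finset (Fin n), (#U : ℝ) < 3 * x ∧
        d * #U < 3 * #((graphAt π m₁).edgesWithin U)} +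
      prob {π : PairOrdering n | ∃ A B : Finset (Fin n), Disjoint A B ∧ x / 2 ≤ #A ∧ x / 2 ≤ #B ∧
        ∀ i, ∃ c, π.symm (pairPositions n k hk (i, c)) ∉ crossPairs A B}) ≤
    prob {π : PairOrdering n |
      hittingTime π (GraphGame.makersWin (GraphGame.perfMatch (Fin n))) =
        hittingTime π (GraphGame.minDegreeAtLeast (Fin n) 2)} := by
  rw [sub_le_comm, ← prob_compl]
  refine le_trans (prob_mono ?_) ((prob_union_le _ _).trans (add_le_add_left
    ((prob_union_le _ _).trans (add_le_add_left ((prob_union_le _ _).trans (add_le_add_left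
      ((prob_union_le _ _).trans (add_le_add_left (prob_union_le _ _) _)) _)) _)) _))
  intro π hπ
  by_contra hno
  simp only [Set.mem_union, not_or] at hno
  obtain ⟨⟨⟨⟨⟨hA, hB⟩, hC⟩, hD⟩, hE⟩, hF⟩ := hno
  simp only [Set.mem_ofPred_eq] at hA hB hC hD hE hF
  push Not at hB hC hD hE hF
  exact hπ (hittingTime_makersWin_eq hn hk hkm hm₁ hd hds h6 hA hB hC hD hE hF)

end GraphProcess

/-! ### Estimates for large graphs -/

namespace GraphProcess

open Finset SimpleGraph Filter

section Asymptotics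

variable {n : ℕ} {C : ℕ} {ℓ : ℝ}

/-- The standing numerical assumptions: `ℓ` is the logarithm of `n`, and both are large. -/
structure IsLarge (n C : ℕ) (ℓ : ℝ) : Prop where
  exp_eq : Real.exp ℓ = n
  le_log : 1000 + 300 * (C : ℝ) ≤ ℓ
  log_le : 1000 * ℓ ≤ n

theorem eventually_isLarge (C : ℕ) : ∀ᶠ n : ℕ in atTop, IsLarge n C (Real.log n) := by
  have h1 : Tendsto (fun n : ℕ => Real.log n) atTop atTop :=
    Real.tendsto_log_atTop.comp tendsto_natCast_atTop_atTop
  have h2 : ∀ᶠ n : ℕ in atTop, 1000 * Real.log n ≤ n := by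
    have h3 := tendsto_natCast_atTop_atTop (R := ℝ) |>.eventually
      (Real.isLittleO_log_id_atTop.bound (show (0 : ℝ) < 1 / 1000 by norm_num))
    filter_upwards [h3] with n hn
    simp only [id_eq, Real.norm_eq_abs, Nat.abs_cast] at hn
    have := le_abs_self (Real.log n)
    linarith
  filter_upwards [h1.eventually_ge_atTop (1000 + 300 * (C : ℝ)), h2, eventually_gt_atTop 0]
    with n hn1 hn2 hn3
  exact ⟨Real.exp_log (by exact_mod_cast hn3), hn1, hn2⟩

namespace IsLarge

variable (h : IsLarge n C ℓ)
include h

theorem log_ge : 1000 ≤ ℓ := by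
  have := h.le_log
  have : (0 : ℝ) ≤ C := by positivity
  linarith

theorem cast_ge : (1000000 : ℝ) ≤ n := by
  have := h.log_ge
  have := h.log_le
  linarith

theorem ten_le : 10 ≤ n := by
  have := h.cast_ge
  have : (10 : ℝ) ≤ n := by linarith
  exact_mod_cast this

theorem choose_ge : (0.4999 : ℝ) * n ^ 2 ≤ (n.choose 2 : ℕ) := by
  rw [Nat.cast_choose_two]
  have := h.cast_ge
  nlinarith

theorem choose_le : ((n.choose 2 : ℕ) : ℝ) ≤ (n : ℝ) ^ 2 / 2 := (choose_two_bounds h.ten_le).2.2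

theorem floor_le : (⌊n * ℓ⌋₊ : ℝ) ≤ n * ℓ :=
  Nat.floor_le (mul_nonneg (Nat.cast_nonneg _) (by linarith [h.log_ge]))

theorem floor_le' : (⌊3 / 8 * (n * ℓ)⌋₊ : ℝ) ≤ 3 / 8 * (n * ℓ) :=
  Nat.floor_le (mul_nonneg (by norm_num) (mul_nonneg (Nat.cast_nonneg _) (by linarith [h.log_ge])))

theorem floor_le_choose : ⌊n * ℓ⌋₊ ≤ n.choose 2 := by
  have h1 := h.floor_le
  have h2 := h.choose_ge
  have h3 := h.log_le
  have h4 := h.cast_ge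
  have : (⌊n * ℓ⌋₊ : ℝ) ≤ (n.choose 2 : ℕ) := by nlinarith
  exact_mod_cast this

theorem floor_le_floor : ⌊3 / 8 * (n * ℓ)⌋₊ ≤ ⌊n * ℓ⌋₊ := by
  apply Nat.floor_le_floor
  have : 0 ≤ n * ℓ := mul_nonneg (Nat.cast_nonneg _) (by linarith [h.log_ge])
  linarith

theorem two_mul_le_floor : 2 * (C * n) ≤ ⌊3 / 8 * (n * ℓ)⌋₊ := by
  apply Nat.le_floor
  push_cast
  have := h.le_log
  have := h.cast_ge
  have : (0 : ℝ) ≤ C := by positivity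
  nlinarith

/-- The `3nℓ/8` positions out of about `n²/2` give density about `0.75 ℓ / n`; the constant `0.72`
absorbs the first `2Cn` positions and the rounding. -/
theorem card_window_ge :
    0.72 * ℓ / n ≤ (#(window n (2 * (C * n)) ⌊3 / 8 * (n * ℓ)⌋₊) : ℝ) / (n.choose 2 : ℕ) := by
  have h1 := h.cast_ge
  have h2 := h.choose_le
  have h3 := h.choose_ge
  have h4 := Nat.lt_floor_add_one (3 / 8 * (n * ℓ))
  have h5 := h.le_log
  rw [card_window (h.floor_le_floor.trans h.floor_le_choose), Nat.cast_sub h.two_mul_le_floor]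
  push_cast
  have hN : (0 : ℝ) < (n.choose 2 : ℕ) := by nlinarith
  rw [div_le_div_iff₀ (by linarith) hN]
  have h6 : 0.36 * (n * ℓ) ≤ (⌊3 / 8 * (n * ℓ)⌋₊ : ℝ) - 2 * (C * n) := by
    have : (0 : ℝ) ≤ C := by positivity
    nlinarith
  have h7 : 0 ≤ 0.72 * ℓ := by linarith [h.log_ge]
  calc 0.72 * ℓ * (n.choose 2 : ℕ) ≤ 0.72 * ℓ * ((n : ℝ) ^ 2 / 2) := by gcongr
    _ = 0.36 * (n * ℓ) * n := by ring
    _ ≤ _ := by gcongr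

theorem card_window_zero_ge :
    1.9 * ℓ / n ≤ (#(window n 0 ⌊n * ℓ⌋₊) : ℝ) / (n.choose 2 : ℕ) := by
  have h1 := h.cast_ge
  have h2 := h.choose_le
  have h3 := h.choose_ge
  have h4 := Nat.lt_floor_add_one (n * ℓ)
  have h5 := h.log_ge
  rw [card_window h.floor_le_choose, Nat.sub_zero]
  have hN : (0 : ℝ) < (n.choose 2 : ℕ) := by nlinarith
  rw [div_le_div_iff₀ (by linarith) hN]
  have h6 : 0.95 * (n * ℓ) ≤ (⌊n * ℓ⌋₊ : ℝ) := by nlinarith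
  calc 1.9 * ℓ * (n.choose 2 : ℕ) ≤ 1.9 * ℓ * ((n : ℝ) ^ 2 / 2) := by gcongr
    _ = 0.95 * (n * ℓ) * n := by ring
    _ ≤ _ := by gcongr

theorem card_window_zero_le :
    (#(window n 0 ⌊n * ℓ⌋₊) : ℝ) / (n.choose 2 : ℕ) ≤ 4 * ℓ / n := by
  have h1 := h.cast_ge
  have h3 := h.choose_ge
  have h4 := h.floor_le
  have h5 := h.log_ge
  rw [card_window h.floor_le_choose, Nat.sub_zero]
  have hN : (0 : ℝ) < (n.choose 2 : ℕ) := by nlinarith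
  rw [div_le_div_iff₀ hN (by linarith)]
  calc (⌊n * ℓ⌋₊ : ℝ) * n ≤ n * ℓ * n := by gcongr
    _ ≤ 4 * ℓ * (0.4999 * n ^ 2) := by nlinarith [mul_nonneg (by linarith : 0 ≤ ℓ) (sq_nonneg (n : ℝ))]
    _ ≤ _ := by gcongr

theorem eight_rpow_le (c : ℝ) (hc : 0 ≤ c) :
    (8 : ℝ) ^ (c * ℓ) ≤ Real.exp (2.08 * c * ℓ) := by
  rw [Real.rpow_def_of_pos (by norm_num)]
  apply Real.exp_le_exp.2
  have h1 : Real.log 8 ≤ 2.08 := by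
    rw [show (8 : ℝ) = 2 ^ 3 by norm_num, Real.log_pow]
    have := Real.log_two_lt_d9
    push_cast
    linarith
  have : 0 ≤ c * ℓ := mul_nonneg hc (by linarith [h.log_ge])
  nlinarith

/-- Average degree about `0.75 ℓ`, bounded here by `0.8 ℓ`, leaves at least `exp (0.2 ℓ)` isolated
vertices in expectation. -/
theorem prob_minDegree_ge_two :
    prob {π : PairOrdering n |
      graphAt π ⌊3 / 8 * (n * ℓ)⌋₊ ∈ GraphGame.minDegreeAtLeast (Fin n) 2} ≤
      Real.exp (-(0.2 * ℓ)) + 0.8 * ℓ * Real.exp (-ℓ) := by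
  have h1 := h.cast_ge
  have h3 := h.choose_ge
  have h4 := h.floor_le'
  have h5 := h.log_ge
  have h6 := h.log_le
  have hn0 : (0 : ℝ) < n := by linarith
  set m := ⌊3 / 8 * (n * ℓ)⌋₊ with hm
  have hD : 0.47 * (n : ℝ) ^ 2 ≤ (n.choose 2 : ℕ) - n - m := by nlinarith
  have hlt : n + m < n.choose 2 := by
    have : ((n + m : ℕ) : ℝ) < (n.choose 2 : ℕ) := by push_cast; nlinarith
    exact_mod_cast this
  have hη : (m : ℝ) / ((n.choose 2 : ℕ) - n - m) ≤ 0.8 * ℓ / n := by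
    rw [div_le_div_iff₀ (by nlinarith) hn0]
    calc (m : ℝ) * n ≤ 3 / 8 * (n * ℓ) * n := by gcongr
      _ ≤ 0.8 * ℓ * (0.47 * n ^ 2) := by
        nlinarith [mul_nonneg (by linarith : 0 ≤ ℓ) (sq_nonneg (n : ℝ))]
      _ ≤ _ := by gcongr
  refine (prob_minDegree_ge_two_le h.ten_le hlt).trans ?_
  have e1 : (n : ℝ) * (m / ((n.choose 2 : ℕ) - n - m)) ≤ 0.8 * ℓ := by
    calc _ ≤ (n : ℝ) * (0.8 * ℓ / n) := by gcongr
      _ = _ := by field_simp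
  refine add_le_add ?_ ?_
  · rw [div_le_iff₀ hn0, ← h.exp_eq, ← Real.exp_add]
    apply Real.exp_le_exp.2
    rw [h.exp_eq]
    linarith
  · refine hη.trans (le_of_eq ?_)
    rw [← h.exp_eq, Real.exp_neg, div_eq_mul_inv]

theorem prob_minDegree_lt_two :
    prob {π : PairOrdering n |
      graphAt π ⌊n * ℓ⌋₊ ∉ GraphGame.minDegreeAtLeast (Fin n) 2} ≤
      Real.exp 75 * Real.exp (-(0.6 * ℓ)) := by
  have h1 := h.cast_ge
  have h2 := h.card_window_zero_ge
  have h5 := h.log_ge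
  have hn0 : (0 : ℝ) < n := by linarith
  refine (prob_minDegree_lt_two_le h.ten_le _).trans ?_
  have e1 : 1.6 * ℓ ≤ 7 / 8 * ((n : ℝ) - 1) *
      (#(window n 0 ⌊n * ℓ⌋₊) / (n.choose 2 : ℕ)) := by
    calc 1.6 * ℓ = 1.6 * n * (ℓ / n) := by field_simp
      _ ≤ 7 / 8 * ((n : ℝ) - 1) * (1.9 * (ℓ / n)) := by
        have : 0 ≤ ℓ / n := by positivity
        nlinarith
      _ ≤ _ := by
        rw [← mul_div_assoc]
        gcongr
        linarith
  have e2 : (8 : ℝ) ^ (1 : ℝ) ≤ Real.exp 3 := by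
    have := Real.add_one_le_exp (1 : ℝ)
    rw [Real.rpow_one, show (3 : ℝ) = (3 : ℕ) * 1 by norm_num, Real.exp_nat_mul]
    calc (8 : ℝ) = (1 + 1) ^ 3 := by norm_num
      _ ≤ _ := by gcongr
  calc (n : ℝ) * (Real.exp 72 * (8 : ℝ) ^ (1 : ℝ) * Real.exp (-(7 / 8 * ((n : ℝ) - 1) *
        (#(window n 0 ⌊n * ℓ⌋₊) / (n.choose 2 : ℕ)))))
      ≤ n * (Real.exp 72 * Real.exp 3 * Real.exp (-(1.6 * ℓ))) := by gcongr
    _ = Real.exp ℓ * (Real.exp 72 * Real.exp 3 * Real.exp (-(1.6 * ℓ))) := by rw [h.exp_eq]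
    _ = _ := by simp only [← Real.exp_add]; congr 1; ring

/-- A path of length `r` has `n ^ (r + 1)` placements and edge probability at most `(4ℓ / n) ^ r`,
leaving a factor `n`. Two small ends cost `exp (-1.2 ℓ)` up to `exp (0.1 ℓ)`, which beats `n = exp
ℓ`. Hence the choice of `3/8`: average degree below `ℓ`, so that isolated vertices survive, but
twice it well above `ℓ`. -/
theorem prob_not_farApart :
    prob {π : PairOrdering n | ¬ GraphGame.FarApart (graphAt π ⌊n * ℓ⌋₊)
      (smallVertices π (2 * (C * n)) ⌊3 / 8 * (n * ℓ)⌋₊ (ℓ / 50))} ≤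
      ∑ r ∈ Icc 1 4, Real.exp 72 * ((4 * ℓ) ^ r * Real.exp (-(0.1 * ℓ))) := by
  have h1 := h.cast_ge
  have h2 := h.card_window_ge
  have h3 := h.card_window_zero_le
  have h5 := h.log_ge
  have hn0 : (0 : ℝ) < n := by linarith
  refine (prob_not_farApart_le h.ten_le _ _ _ _).trans (sum_le_sum fun r _ => ?_)
  have e1 : 1.2 * ℓ ≤ 7 / 8 * (2 * (n : ℝ) - 7) *
      (#(window n (2 * (C * n)) ⌊3 / 8 * (n * ℓ)⌋₊) / (n.choose 2 : ℕ)) := by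
    calc 1.2 * ℓ = 1.2 * n * (ℓ / n) := by field_simp
      _ ≤ 7 / 8 * (2 * (n : ℝ) - 7) * (0.72 * (ℓ / n)) := by
        have : 0 ≤ ℓ / n := by positivity
        nlinarith
      _ ≤ _ := by
        rw [← mul_div_assoc]
        gcongr
        linarith
  have e2 : (8 : ℝ) ^ (2 * (ℓ / 50)) ≤ Real.exp (0.1 * ℓ) := by
    rw [show 2 * (ℓ / 50) = 1 / 25 * ℓ by ring]
    refine (h.eight_rpow_le _ (by norm_num)).trans (Real.exp_le_exp.2 ?_)
    linarith
  calc _ ≤ (n : ℝ) ^ (r + 1) * (Real.exp 72 * Real.exp (0.1 * ℓ) * (4 * ℓ / n) ^ r *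
        Real.exp (-(1.2 * ℓ))) := by gcongr
    _ = Real.exp 72 * ((4 * ℓ) ^ r * (n * (Real.exp (0.1 * ℓ) * Real.exp (-(1.2 * ℓ))))) := by
      rw [div_pow, pow_succ]; field_simp
    _ = _ := by
      rw [← h.exp_eq]
      simp only [← Real.exp_add]
      congr 3
      ring

theorem prob_card_smallVertices {κ : ℝ} (hκ : 0 < κ) :
    prob {π : PairOrdering n | κ * n / 2 ≤
      #(smallVertices π (2 * (C * n)) ⌊3 / 8 * (n * ℓ)⌋₊ (ℓ / 50))} ≤
      2 / κ * Real.exp 72 * Real.exp (-(0.5 * ℓ)) := by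
  have h1 := h.cast_ge
  have h2 := h.card_window_ge
  have h5 := h.log_ge
  have hn0 : (0 : ℝ) < n := by linarith
  refine (prob_card_smallVertices_le h.ten_le _ _ _ (by positivity)).trans ?_
  have e1 : 0.6 * ℓ ≤ 7 / 8 * ((n : ℝ) - 1) *
      (#(window n (2 * (C * n)) ⌊3 / 8 * (n * ℓ)⌋₊) / (n.choose 2 : ℕ)) := by
    calc 0.6 * ℓ = 0.6 * n * (ℓ / n) := by field_simp
      _ ≤ 7 / 8 * ((n : ℝ) - 1) * (0.72 * (ℓ / n)) := by
        have : 0 ≤ ℓ / n := by positivity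
        nlinarith
      _ ≤ _ := by
        rw [← mul_div_assoc]
        gcongr
        linarith
  have e2 : (8 : ℝ) ^ (ℓ / 50) ≤ Real.exp (0.1 * ℓ) := by
    rw [show ℓ / 50 = 1 / 50 * ℓ by ring]
    refine (h.eight_rpow_le _ (by norm_num)).trans (Real.exp_le_exp.2 ?_)
    linarith
  calc _ ≤ n * (Real.exp 72 * Real.exp (0.1 * ℓ) * Real.exp (-(0.6 * ℓ))) / (κ * n / 2) := by gcongr
    _ = 2 / κ * Real.exp 72 * (Real.exp (0.1 * ℓ) * Real.exp (-(0.6 * ℓ))) := by field_simp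
    _ = _ := by rw [← Real.exp_add]; congr 2; ring

theorem prob_dense {κ : ℝ} (hκ1 : κ ≤ Real.exp (-7200) / 200000) :
    prob {π : PairOrdering n | ∃ U : Finset (Fin n), (#U : ℝ) < 3 * (κ * n) ∧
      ⌊ℓ / 400⌋₊ * #U < 3 * #((graphAt π ⌊n * ℓ⌋₊).edgesWithin U)} ≤
      Real.exp (Real.exp (-(2 * ℓ))) - 1 := by
  classical
  have h1 := h.cast_ge
  have h3 := h.choose_ge
  have h5 := h.log_ge
  have h6 := h.log_le
  have hn0 : (0 : ℝ) < n := by linarith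
  set d := ⌊ℓ / 400⌋₊ with hd
  have hd1 : (d : ℝ) ≤ ℓ / 400 := Nat.floor_le (by linarith)
  have hd2 : ℓ / 800 ≤ d := by
    have := Nat.lt_floor_add_one (ℓ / 400)
    rw [← hd] at this
    linarith
  refine (prob_le_sum (univ.erase ∅) (B := fun U => {π : PairOrdering n |
    (#U : ℝ) < 3 * (κ * n) ∧ d * #U < 3 * #((graphAt π ⌊n * ℓ⌋₊).edgesWithin U)}) ?_).trans
    ((sum_le_sum (g := fun U => Real.exp (-(3 * ℓ * #U))) fun U hU => ?_).trans
      ((sum_exp_card_le n (3 * ℓ)).trans_eq ?_))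
  · rintro π ⟨U, hU, hU'⟩
    refine ⟨U, mem_erase.2 ⟨?_, mem_univ U⟩, hU, hU'⟩
    rintro rfl
    have : (graphAt π ⌊n * ℓ⌋₊).edgesWithin ∅ = ∅ := by
      ext e
      rw [mem_edgesWithin]
      simp only [notMem_empty, iff_false, not_and]
      intro _ hall
      induction e using Sym2.ind with
      | _ a b => exact hall a (Sym2.mem_mk_left a b)
    rw [this] at hU'
    simp at hU'
  · by_cases hUn : (#U : ℝ) < 3 * (κ * n)
    · have hU0 : (0 : ℝ) < #U := by
        exact_mod_cast card_pos.2 (nonempty_iff_ne_empty.2 (mem_erase.1 hU).1)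
      have hUle : (#U : ℝ) ≤ n := by
        have := card_le_univ U
        rw [Fintype.card_fin] at this
        exact_mod_cast this
      -- The least number of edges violating sparsity. As `d ≥ ℓ / 800`, it is at least `#U * ℓ /
      -- 2400`.
      set r := d * #U / 3 + 1 with hr
      have hr1 : (d : ℝ) * #U / 3 ≤ r := by
        have : d * #U ≤ 3 * r := by omega
        have : (d : ℝ) * #U ≤ 3 * r := by exact_mod_cast this
        linarith
      have hr2 : (r : ℝ) ≤ d * #U + 1 := by
        have : r ≤ d * #U + 1 := by
          have := Nat.div_le_self (d * #U) 3
          omega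
        exact_mod_cast this
      have hr3 : (r : ℝ) ≤ 0.1 * n ^ 2 := by
        have : (d : ℝ) * #U ≤ ℓ / 400 * n := by gcongr
        nlinarith
      have hr4 : #U * ℓ / 2400 ≤ r := by
        refine le_trans ?_ hr1
        nlinarith
      have hrpos : (0 : ℝ) < r := by positivity
      have hrN : r < n.choose 2 := by
        have : (r : ℝ) < (n.choose 2 : ℕ) := by nlinarith
        exact_mod_cast this
      set p : ℝ := (#(window n 0 ⌊n * ℓ⌋₊) : ℝ) / ((n.choose 2 : ℕ) - r : ℝ) with hp
      have hpd : 0.39 * (n : ℝ) ^ 2 ≤ (n.choose 2 : ℕ) - r := by linarith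
      have hp0 : 0 ≤ p := div_nonneg (Nat.cast_nonneg _) (by nlinarith)
      have hp1 : p ≤ 8 * ℓ / n := by
        rw [hp, div_le_div_iff₀ (by nlinarith) hn0, card_window h.floor_le_choose, Nat.sub_zero]
        have h4 := h.floor_le
        calc (⌊n * ℓ⌋₊ : ℝ) * n ≤ n * ℓ * n := by gcongr
          _ ≤ 8 * ℓ * (0.39 * n ^ 2) := by
            nlinarith [mul_nonneg (by linarith : 0 ≤ ℓ) (sq_nonneg (n : ℝ))]
          _ ≤ _ := by gcongr
      have e1 : prob {π : PairOrdering n | (#U : ℝ) < 3 * (κ * n) ∧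
          d * #U < 3 * #((graphAt π ⌊n * ℓ⌋₊).edgesWithin U)} ≤
          ((#U ^ 2).choose r : ℝ) * p ^ r := by
        refine (prob_mono ?_).trans (prob_le_card_edgesWithin_le U ⌊n * ℓ⌋₊ hrN)
        rintro π ⟨-, hπ⟩
        simp only [Set.mem_ofPred_eq]
        omega
      have e2 := choose_mul_pow_le (#U ^ 2) r (by omega) hp0
      -- The left side is at most `2.72 * 8 * 2400 * #U / n` with `#U < 3κn`, and `2.72 * 19200 * 3
      -- < 200000`. The exponent `7200 = 3 * 2400` turns `r ≥ #U * ℓ / 2400` into the bound `exp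
      -- (-(3 * ℓ * #U))`, which beats the number of sets `U`.
      have e3 : Real.exp 1 * ((#U ^ 2 : ℕ) : ℝ) * p / r ≤ Real.exp (-7200) := by
        rw [div_le_iff₀ hrpos]
        push_cast
        have e4 := Real.exp_one_lt_d9
        have e5 : (#U : ℝ) / n ≤ 3 * κ := by rw [div_le_iff₀ hn0]; linarith
        calc Real.exp 1 * (#U : ℝ) ^ 2 * p ≤ 2.72 * (#U : ℝ) ^ 2 * (8 * ℓ / n) := by
              gcongr; linarith
          _ = (2.72 * 19200 * (#U / n)) * (#U * ℓ / 2400) := by field_simp; norm_num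
          _ ≤ (2.72 * 19200 * (3 * κ)) * (#U * ℓ / 2400) := by gcongr
          _ ≤ Real.exp (-7200) * (#U * ℓ / 2400) := by
            have : 0 < Real.exp (-7200) := Real.exp_pos _
            gcongr
            linarith
          _ ≤ _ := by gcongr
      refine e1.trans (e2.trans ?_)
      calc _ ≤ Real.exp (-7200) ^ r := by gcongr
        _ = Real.exp (-(7200 * r)) := by rw [← Real.exp_nat_mul]; congr 1; ring
        _ ≤ _ := Real.exp_le_exp.2 (by linarith)
    · refine le_trans (le_of_eq ?_) (Real.exp_pos _).le
      have : {π : PairOrdering n | (#U : ℝ) < 3 * (κ * n) ∧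
          d * #U < 3 * #((graphAt π ⌊n * ℓ⌋₊).edgesWithin U)} = ∅ := by
        ext π; simp [hUn]
      simp only [this, prob, Set.ncard_empty, Nat.cast_zero, zero_div]
  · congr 2
    rw [← h.exp_eq, ← Real.exp_add]
    congr 1
    ring

theorem two_mul_lt_choose : 2 * (C * n) < n.choose 2 := by
  have h1 := h.cast_ge
  have h3 := h.choose_ge
  have h5 := h.le_log
  have h6 := h.log_le
  have : ((2 * (C * n) : ℕ) : ℝ) < (n.choose 2 : ℕ) := by push_cast; nlinarith
  exact_mod_cast this

theorem prob_no_pair_joining {κ : ℝ} (hκ : 0 < κ) (hC : 16 / κ ^ 4 ≤ C) :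
    prob {π : PairOrdering n | ∃ A B : Finset (Fin n), Disjoint A B ∧ κ * n / 2 ≤ #A ∧
      κ * n / 2 ≤ #B ∧ ∀ i, ∃ c,
        π.symm (pairPositions n (C * n) h.two_mul_lt_choose.le (i, c)) ∉ crossPairs A B} ≤
      Real.exp (32 * C ^ 2) * Real.exp (-ℓ) := by
  have h1 := h.cast_ge
  have h2 := h.choose_le
  have h3 := h.choose_ge
  have h4 := h.log_ge
  have h5 := h.le_log
  have h6 := h.log_le
  have hn0 : (0 : ℝ) < n := by linarith
  have hC0 : (0 : ℝ) ≤ C := by positivity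
  have hN : (0 : ℝ) < (n.choose 2 : ℕ) := by nlinarith
  refine (prob_no_pair_joining_le h.two_mul_lt_choose (y := κ * n / 2) (by positivity)).trans ?_
  push_cast
  have e1 : (2 * ((C : ℝ) * n)) ^ 2 / ((n.choose 2 : ℕ) - 2 * (C * n)) ≤ 32 * C ^ 2 := by
    have hd : (n : ℝ) ^ 2 / 8 ≤ (n.choose 2 : ℕ) - 2 * (C * n) := by nlinarith
    rw [div_le_iff₀ (by nlinarith)]
    calc (2 * ((C : ℝ) * n)) ^ 2 = 32 * C ^ 2 * (n ^ 2 / 8) := by ring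
      _ ≤ _ := by gcongr
  have e2 : κ ^ 2 / 2 ≤ (κ * n / 2) ^ 2 / (n.choose 2 : ℕ) := by
    rw [le_div_iff₀ hN]
    calc κ ^ 2 / 2 * (n.choose 2 : ℕ) ≤ κ ^ 2 / 2 * ((n : ℝ) ^ 2 / 2) := by gcongr
      _ = _ := by ring
  -- The choice `C ≥ 16 / κ ^ 4` makes the exponent at least `4n`, which beats `4 ^ n ≤ exp (3n)`.
  have e3 : 4 * (n : ℝ) ≤ C * n * ((κ * n / 2) ^ 2 / (n.choose 2 : ℕ)) ^ 2 := by
    rw [div_le_iff₀ (by positivity)] at hC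
    calc 4 * (n : ℝ) ≤ (C * κ ^ 4) / 4 * n := by nlinarith
      _ = C * n * (κ ^ 2 / 2) ^ 2 := by ring
      _ ≤ _ := by gcongr
  have e4 : (4 : ℝ) ^ n ≤ Real.exp (3 * n) := by
    rw [mul_comm, Real.exp_nat_mul]
    have := Real.add_one_le_exp (3 : ℝ)
    gcongr
    linarith
  calc _ ≤ Real.exp (3 * n) * (Real.exp (32 * C ^ 2) * Real.exp (-(4 * n))) := by gcongr
    _ = Real.exp (32 * C ^ 2) * Real.exp (-n) := by
      simp only [← Real.exp_add]; congr 1; ring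
    _ ≤ _ := by gcongr; linarith

end IsLarge

end Asymptotics

end GraphProcess

/-! ### Conclusion -/

namespace GraphProcess

open Finset Filter

/-- An upper bound for the failure probability, as a function of the logarithm of the number of
vertices. -/
noncomputable def failureBound (κ C ℓ : ℝ) : ℝ :=
  (Real.exp (-(0.2 * ℓ)) + 0.8 * ℓ * Real.exp (-ℓ)) + Real.exp 75 * Real.exp (-(0.6 * ℓ)) +
    (∑ r ∈ Icc 1 4, Real.exp 72 * ((4 * ℓ) ^ r * Real.exp (-(0.1 * ℓ)))) +
    2 / κ * Real.exp 72 * Real.exp (-(0.5 * ℓ)) + (Real.exp (Real.exp (-(2 * ℓ))) - 1) +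
    Real.exp (32 * C ^ 2) * Real.exp (-ℓ)

theorem tendsto_failureBound (κ C : ℝ) : Tendsto (failureBound κ C) atTop (nhds 0) := by
  have h1 : ∀ c : ℝ, 0 < c → Tendsto (fun ℓ : ℝ => Real.exp (-(c * ℓ))) atTop (nhds 0) :=
    fun c hc => Real.tendsto_exp_neg_atTop_nhds_zero.comp (tendsto_id.const_mul_atTop hc)
  have h2 : ∀ r : ℕ, Tendsto (fun ℓ : ℝ => (4 * ℓ) ^ r * Real.exp (-(0.1 * ℓ))) atTop (nhds 0) := by
    intro r
    have h3 := ((Real.tendsto_pow_mul_exp_neg_atTop_nhds_zero r).comp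
      (tendsto_id.const_mul_atTop (show (0 : ℝ) < 0.1 by norm_num))).const_mul ((40 : ℝ) ^ r)
    rw [mul_zero] at h3
    refine h3.congr fun ℓ => ?_
    simp only [Function.comp_apply, id_eq]
    rw [← mul_assoc, ← mul_pow]
    congr 2
    ring
  have h4 : Tendsto (fun ℓ : ℝ => Real.exp (-ℓ)) atTop (nhds 0) :=
    Real.tendsto_exp_neg_atTop_nhds_zero
  have h5 : Tendsto (fun ℓ : ℝ => 0.8 * ℓ * Real.exp (-ℓ)) atTop (nhds 0) := by
    have := (Real.tendsto_pow_mul_exp_neg_atTop_nhds_zero 1).const_mul (0.8 : ℝ)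
    rw [mul_zero] at this
    exact this.congr fun ℓ => by ring
  have h6 : Tendsto (fun ℓ : ℝ => Real.exp (Real.exp (-(2 * ℓ))) - 1) atTop (nhds 0) := by
    have := ((Real.continuous_exp.tendsto 0).comp (h1 2 (by norm_num))).sub_const 1
    simpa using this
  have h7 := tendsto_finsetSum (Icc 1 4) fun r _ => (h2 r).const_mul (Real.exp 72)
  have := (((((h1 0.2 (by norm_num)).add h5).add
    ((h1 0.6 (by norm_num)).const_mul (Real.exp 75))).add h7).add
    ((h1 0.5 (by norm_num)).const_mul (2 / κ * Real.exp 72))).add h6 |>.add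
    (h4.const_mul (Real.exp (32 * C ^ 2)))
  simp only [mul_zero, sum_const_zero, add_zero] at this
  exact this

theorem one_sub_failureBound_le {n C : ℕ} {κ : ℝ} (hn : Even n) (h : IsLarge n C (Real.log n))
    (hκ : 0 < κ) (hκ1 : κ ≤ Real.exp (-7200) / 200000) (hC : 16 / κ ^ 4 ≤ C) :
    1 - failureBound κ C (Real.log n) ≤ prob {π : PairOrdering n |
      hittingTime π (GraphGame.makersWin (GraphGame.perfMatch (Fin n))) =
        hittingTime π (GraphGame.minDegreeAtLeast (Fin n) 2)} := by
  have h10 := h.ten_le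
  have : NeZero n := ⟨by omega⟩
  have hℓ := h.log_ge
  have hd1 : (⌊Real.log n / 400⌋₊ : ℝ) ≤ Real.log n / 400 := Nat.floor_le (by linarith)
  have hκ6 : 6 * (κ * n) ≤ n := by
    have : Real.exp (-7200) ≤ 1 := Real.exp_le_one_iff.2 (by norm_num)
    have h2 : κ ≤ 1 / 6 := by linarith
    have h3 := mul_le_mul_of_nonneg_right h2 (Nat.cast_nonneg (α := ℝ) n)
    linarith
  refine le_trans ?_ (one_sub_le_prob_hittingTime_eq hn (d := ⌊Real.log n / 400⌋₊)
    (s := Real.log n / 50) (x := κ * n) h.two_mul_lt_choose.le h.two_mul_le_floor h.floor_le_choose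
    (Nat.floor_pos.2 (by linarith)) (by linarith) hκ6)
  refine sub_le_sub_left ?_ 1
  have hA := h.prob_minDegree_ge_two
  have hB := h.prob_minDegree_lt_two
  have hC' := h.prob_not_farApart
  have hD := h.prob_card_smallVertices hκ
  have hE := h.prob_dense hκ1
  have hF := h.prob_no_pair_joining hκ hC
  exact add_le_add (add_le_add (add_le_add (add_le_add (add_le_add hA hB) hC') hD) hE) hF

end GraphProcess

theorem mainTheorem2 :
    Filter.Tendsto
      (fun m : ℕ => GraphProcess.prob
        {π : GraphProcess.PairOrdering (2 * m) |
          GraphProcess.hittingTime π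
              (GraphGame.makersWin (GraphGame.perfMatch (Fin (2 * m)))) =
            GraphProcess.hittingTime π (GraphGame.minDegreeAtLeast (Fin (2 * m)) 2)})
      Filter.atTop (nhds 1) := by
  -- The constants are fixed in this order: `κ` for local sparsity, then `C` in terms of `κ` for
  -- joining large sets, then `n` large in terms of `C`.
  set κ : ℝ := Real.exp (-7200) / 200000 with hκ
  have hκ0 : 0 < κ := by positivity
  set C : ℕ := ⌈16 / κ ^ 4⌉₊
  have htwo : Filter.Tendsto (fun m : ℕ => 2 * m) Filter.atTop Filter.atTop :=
    Filter.tendsto_id.const_mul_atTop' two_pos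
  have hlog : Filter.Tendsto (fun m : ℕ => Real.log ((2 * m : ℕ) : ℝ)) Filter.atTop Filter.atTop :=
    Real.tendsto_log_atTop.comp (tendsto_natCast_atTop_atTop.comp htwo)
  have hlim := ((GraphProcess.tendsto_failureBound κ C).comp hlog).const_sub 1
  rw [sub_zero] at hlim
  refine tendsto_of_tendsto_of_tendsto_of_le_of_le' hlim tendsto_const_nhds ?_
    (Filter.Eventually.of_forall fun m => GraphProcess.prob_le_one _)
  filter_upwards [htwo.eventually (GraphProcess.eventually_isLarge C)] with m hm
  exact GraphProcess.one_sub_failureBound_le (even_two_mul m) hm hκ0 hκ.le (Nat.le_ceil _)
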